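/- **Stability of Homogeneous Equilibrium.** Consider a homogeneous market: $Q\ge 1$ disjoint paths $r$ with $I\ge 1$ ISPs each (so the set $N$ of ISPs has $QI$ elements; $r(n)$ is the path of ISP $n$) and a finite set $K\neq\emptyset$ of attributes. Each ISP $n$ chooses attributes $\mathbf a_n=(a_{nk})_{k\in K}\in\mathbb R_{\ge 0}^K$; path $r$ has valuation $v_r(\mathbf A)=\alpha_0+\alpha_1\sum_{n\in r}\sum_{k}a_{nk}$, and the profit of ISP $n$ is $$\pi_n(\mathbf A)=\frac{d\,v_{r(n)}(\mathbf A)}{1+\sum_{r'}v_{r'}(\mathbf A)}\Big(\rho-\phi_1\sum_k a_{nk}-\phi_0\Big)-\gamma_1\sum_k a_{nk}-\gamma_0 ,$$ with $\alpha_1,\rho>0$, $\alpha_0,\phi_1,\phi_0,\gamma_1,\gamma_0,d\ge 0$, $\phi_0\le\rho$ and $d\phi_1+\gamma_1>0$. A matrix $\mathbf A\ge 0$ is a Nash equilibrium if each $\mathbf a_n$ maximizes $\pi_n$ over $\mathbb R_{\ge 0}^K$ given the attributes of the other ISPs. Profits depend only on the attribute sums $a_n=\sum_k a_{nk}$; let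 $a_n^*(\mathbf A_{-n})\ge 0$ be the profit-maximizing attribute sum of $n$ given those of the other ISPs, and consider on $\mathbb R_{\ge0}^N$ the dynamics $$\dot a_n(t)=a_n^*\big(\mathbf A_{-n}(t)\big)-a_n(t)\qquad(n\in N,\ t\ge 0).$$ Let $a^+=\max(0,\hat a^+)$ with $\hat a^+=\dfrac{\sqrt{T_2^2-4T_1T_3}-T_2}{2T_1}$, where, with $c=\frac{d}{d\phi_1+\gamma_1}$, $$T_1=Q^2I^2\alpha_1^2-c\,(QI-1)(Q-1)I\alpha_1^2\phi_1,$$ $$T_2=2QI\alpha_1(1+Q\alpha_0)-c\Big(\alpha_1\phi_1(QI-1)\big(1+(Q-1)\alpha_0\big)+I\alpha_1(Q-1)\big(\phi_1(1+Q\alpha_0)+\alpha_1(\rho-\phi_0)\big)\Big),$$ $$T_3=(1+Q\alpha_0)^2-c\,\big(1+(Q-1)\alpha_0\big)\big(\phi_1(1+Q\alpha_0)+\alpha_1(\rho-\phi_0)\big).$$ Then: 1. Every $\mathbf A\ge 0$ with $\sum_k a_{nk}=a^+$ for all $n$ is a Nash equilibrium, and the profile $(a^+)_{n\in N}$ is an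 equilibrium (rest point) of the dynamics. 2. If $\phi_1>0$, or $I=1$, or $\hat a^+\le 0$, then $(a^+)_{n\in N}$ is an asymptotically stable equilibrium of the dynamics, i.e. Lyapunov stable and locally attracting (within the state space $\mathbb R_{\ge 0}^N$). 3. In every case, in particular also if $\phi_1=0$, $I\ge 2$ and $\hat a^+>0$, the profile $(a^+)_{n\in N}$ is Lyapunov stable, and every solution that starts close enough to it converges to an equilibrium of the dynamics. Lyapunov stability here includes that a solution for all times $t\ge 0$ exists from every initial state in $\mathbb R_{\ge 0}^N$ near $(a^+)_{n\in N}$. -/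

import Mathlib

open Filter Topology

noncomputable section

/-- A homogeneous market: `Q` disjoint paths for one source-destination pair, each accommodating
`I` identical ISPs, and `K` identically valuable and costly attributes. -/
structure HomogeneousMarket where
  /-- number of paths -/
  Q : ℕ
  /-- number of ISPs on each path -/
  I : ℕ
  /-- number of attributes -/
  K : ℕ
  /-- effect of a unit of attribute on the valuation of a path -/
  α₁ : ℝ
  /-- base valuation of a path -/
  α₀ : ℝ
  /-- revenue per unit of demand -/
  ρ : ℝ
  /-- demand-dependent cost of a unit of attribute -/
  φ₁ : ℝ
  /-- demand-dependent base cost -/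
  φ₀ : ℝ
  /-- demand-independent cost of a unit of attribute -/
  γ₁ : ℝ
  /-- demand-independent base cost -/
  γ₀ : ℝ
  /-- demand limit of the source-destination pair -/
  d : ℝ
  Q_pos : 0 < Q
  I_pos : 0 < I
  K_pos : 0 < K
  α₁_pos : 0 < α₁
  α₀_nonneg : 0 ≤ α₀
  ρ_pos : 0 < ρ
  φ₁_nonneg : 0 ≤ φ₁
  φ₀_nonneg : 0 ≤ φ₀
  φ₀_le_ρ : φ₀ ≤ ρ
  γ₁_nonneg : 0 ≤ γ₁
  γ₀_nonneg : 0 ≤ γ₀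
  d_nonneg : 0 ≤ d
  /-- attributes are not free of cost -/
  cost_pos : 0 < d * φ₁ + γ₁

namespace HomogeneousMarket

variable (m : HomogeneousMarket)

/-- The ISPs of the market: `(r, i)` is the `i`-th ISP on path `r`. -/
abbrev ISP : Type := Fin m.Q × Fin m.I

/-- The valuation `v_r(A)` of path `r` under the attribute matrix `A`. -/
def valuation (A : m.ISP → Fin m.K → ℝ) (r : Fin m.Q) : ℝ :=
  (∑ i : Fin m.I, ∑ k : Fin m.K, m.α₁ * A (r, i) k) + m.α₀

/-- The probability `p_r(A)` that path `r` is selected. -/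
def selectionProb (A : m.ISP → Fin m.K → ℝ) (r : Fin m.Q) : ℝ :=
  m.valuation A r / (1 + ∑ r' : Fin m.Q, m.valuation A r')

/-- The demand `D_n(A)` of ISP `n`, which lies on the single path `n.1`. -/
def demand (A : m.ISP → Fin m.K → ℝ) (n : m.ISP) : ℝ :=
  m.selectionProb A n.1 * m.d

/-- The profit `π_n(A)` of ISP `n`. -/
def profit (A : m.ISP → Fin m.K → ℝ) (n : m.ISP) : ℝ :=
  m.ρ * m.demand A n - ((∑ k : Fin m.K, m.φ₁ * A n k) + m.φ₀) * m.demand A n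
    - ((∑ k : Fin m.K, m.γ₁ * A n k) + m.γ₀)

/-- The attribute vector `x` maximizes the profit of ISP `n` over all nonnegative attribute
vectors, given the rows of `A` that belong to the other ISPs. -/
def IsOptimal (A : m.ISP → Fin m.K → ℝ) (n : m.ISP) (x : Fin m.K → ℝ) : Prop :=
  (∀ k, 0 ≤ x k) ∧ ∀ y : Fin m.K → ℝ, (∀ k, 0 ≤ y k) →
    m.profit (Function.update A n y) n ≤ m.profit (Function.update A n x) n

/-- Nash equilibrium: every ISP has optimal attributes given those of all other ISPs. -/
def IsNash (A : m.ISP → Fin m.K → ℝ) : Prop :=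
  ∀ n, m.IsOptimal A n (A n)

/-- The attribute sum of each ISP. -/
def attributeSum (A : m.ISP → Fin m.K → ℝ) (n : m.ISP) : ℝ := ∑ k : Fin m.K, A n k

/-- `b` is a best response `a_n^*` of ISP `n` to the attribute sums `a` of the other ISPs, i.e. the
attribute sum of an optimal attribute vector of `n`. Since profits depend on attributes only through
attribute sums, the choice of the matrix `A` with the given sums is immaterial. -/
def IsBestResponse (a : m.ISP → ℝ) (n : m.ISP) (b : ℝ) : Prop :=
  ∃ A : m.ISP → Fin m.K → ℝ, (∀ n' k, 0 ≤ A n' k) ∧ m.attributeSum A = a ∧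
    ∃ x : Fin m.K → ℝ, m.IsOptimal A n x ∧ ∑ k, x k = b

/-- `a` solves, for all times `t ≥ 0`, the competition dynamics `a_n' = a_n^*(a_{-n}) - a_n` on the
state space of nonnegative attribute sums (one-sided derivative at `t = 0`). -/
def IsSolution (a : ℝ → m.ISP → ℝ) : Prop :=
  ∀ t : ℝ, 0 ≤ t → ∀ n, 0 ≤ a t n ∧ ∃ b, m.IsBestResponse (a t) n b ∧
    HasDerivWithinAt (fun s => a s n) (b - a t n) (Set.Ici 0) t

/-- `e` is an equilibrium (rest point) of the competition dynamics. -/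
def IsEquilibrium (e : m.ISP → ℝ) : Prop :=
  m.IsSolution (fun _ => e)

/-- Lyapunov stability, including that solutions with initial state near `e` exist for all time. -/
def IsLyapunovStable (e : m.ISP → ℝ) : Prop :=
  ∀ ε > 0, ∃ δ > 0, ∀ x : m.ISP → ℝ, (∀ n, 0 ≤ x n) → dist x e < δ →
    (∃ a, m.IsSolution a ∧ a 0 = x) ∧
    ∀ a, m.IsSolution a → a 0 = x → ∀ t, 0 ≤ t → dist (a t) e < ε

/-- Asymptotic stability: Lyapunov stability and local attractivity. -/
def IsAsymptoticallyStable (e : m.ISP → ℝ) : Prop :=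
  m.IsLyapunovStable e ∧
    ∃ δ > 0, ∀ a, m.IsSolution a → dist (a 0) e < δ → Tendsto a atTop (𝓝 e)

/-- Coefficient `T₁` of the equilibrium formula. -/
def T₁ : ℝ :=
  (m.Q : ℝ) ^ 2 * (m.I : ℝ) ^ 2 * m.α₁ ^ 2
    - m.d / (m.d * m.φ₁ + m.γ₁)
      * ((m.Q : ℝ) * m.I - 1) * ((m.Q : ℝ) - 1) * m.I * m.α₁ ^ 2 * m.φ₁

/-- Coefficient `T₂` of the equilibrium formula. -/
def T₂ : ℝ :=
  2 * m.Q * m.I * m.α₁ * (1 + m.Q * m.α₀)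
    - m.d / (m.d * m.φ₁ + m.γ₁)
      * (m.α₁ * m.φ₁ * ((m.Q : ℝ) * m.I - 1) * (1 + ((m.Q : ℝ) - 1) * m.α₀)
        + m.I * m.α₁ * ((m.Q : ℝ) - 1)
          * (m.φ₁ * (1 + m.Q * m.α₀) + m.α₁ * (m.ρ - m.φ₀)))

/-- Coefficient `T₃` of the equilibrium formula. -/
def T₃ : ℝ :=
  (1 + m.Q * m.α₀) ^ 2
    - m.d / (m.d * m.φ₁ + m.γ₁) * (1 + ((m.Q : ℝ) - 1) * m.α₀)
      * (m.φ₁ * (1 + m.Q * m.α₀) + m.α₁ * (m.ρ - m.φ₀))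

/-- The unrestricted equilibrium attribute sum `â⁺`. -/
def unrestrictedSum : ℝ :=
  (Real.sqrt (m.T₂ ^ 2 - 4 * m.T₁ * m.T₃) - m.T₂) / (2 * m.T₁)

/-- The equilibrium attribute sum `a⁺ = max(0, â⁺)`. -/
def equilibriumSum : ℝ := max 0 m.unrestrictedSum

/-- The profile in which every ISP has attribute sum `a⁺`. -/
def equilibriumProfile : m.ISP → ℝ := fun _ => m.equilibriumSum

end HomogeneousMarket

end

/-! As a function of its own attribute sum, the profit of an ISP is a constant minus a positive
multiple of `X + R / X`, where `X` is the denominator of the selection probabilities and `R`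
(`radicand`) depends only on the other ISPs. So the best response is unique: it moves `X` to `√R`,
truncated where the own sum would become negative (`isBestResponse_iff`). On constant profiles `X ^
2 - R` is the quadratic with coefficients `T₁`, `T₂`, `T₃`, and the signs of these show that `a⁺` is
its root if `T₃ ≤ 0`, and zero if `T₃ ≥ 0`.

If `T₃ > 0`, the best response vanishes near the equilibrium and the dynamics read `a' = -a` there.
If `T₃ ≤ 0`, the untruncated step `drift` vanishes at the equilibrium, and its linearization is
minus a symmetric operator `linForm`. To first order the dynamics are therefore a projected gradient
flow of the form `quadForm`, which decays exponentially wherever it controls the norm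
(`quadForm_decay`). It always controls the path sums (`exists_linearization`, `quadForm_ge`). It
controls all entries if `φ₁ > 0`, if `I = 1`, or if the equilibrium is zero, since nonnegative
entries are bounded by their path sum.

In the remaining case `φ₁ = 0`, `a⁺ > 0`, the drift is the same for all ISPs on a path and depends
on path sums only. Differences within a path are then conserved while the path sums converge, so
each nearby solution converges to a rest point with the same path sums as the symmetric one. Adding
the conserved spread to the form gives a weak Lyapunov function, hence stability. -/

noncomputable section

/-! ### Explicit best responses in terms of attribute sums -/

namespace HomogeneousMarket

variable (m : HomogeneousMarket)

/-- The sum of the attributes on path `r`. -/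
def pathSum (a : m.ISP → ℝ) (r : Fin m.Q) : ℝ := ∑ i, a (r, i)

/-- The sum of the attributes in the market. -/
def total (a : m.ISP → ℝ) : ℝ := ∑ n, a n

/-- One plus the valuations of all paths. -/
def denom (a : m.ISP → ℝ) : ℝ := 1 + m.Q * m.α₀ + m.α₁ * m.total a

/-- One plus the valuations of the paths other than `r`. -/
def rest (a : m.ISP → ℝ) (r : Fin m.Q) : ℝ :=
  1 + ((m.Q : ℝ) - 1) * m.α₀ + m.α₁ * (m.total a - m.pathSum a r)

/-- The margin factor of ISP `n`, which does not depend on the attributes of `n`. -/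
def margin (a : m.ISP → ℝ) (n : m.ISP) : ℝ :=
  m.φ₁ * (1 + m.Q * m.α₀ + m.α₁ * (m.total a - a n)) + m.α₁ * (m.ρ - m.φ₀)

/-- The constant `c = d / (d φ₁ + γ₁)`. -/
def ratio : ℝ := m.d / (m.d * m.φ₁ + m.γ₁)

/-- The square of the unrestricted optimal denominator of ISP `n`. -/
def radicand (a : m.ISP → ℝ) (n : m.ISP) : ℝ := m.ratio * m.rest a n.1 * m.margin a n

/-- The unrestricted optimal change of attribute sum for ISP `n`. -/
def drift (a : m.ISP → ℝ) (n : m.ISP) : ℝ := (√(m.radicand a n) - m.denom a) / m.α₁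

/-- The optimal attribute sum of ISP `n`. -/
def bestResponse (a : m.ISP → ℝ) (n : m.ISP) : ℝ := max 0 (a n + m.drift a n)

/-- The profit of ISP `n` as a function of the attribute sums. -/
def sumProfit (a : m.ISP → ℝ) (n : m.ISP) : ℝ :=
  m.d * ((m.α₁ * m.pathSum a n.1 + m.α₀) / m.denom a) * (m.ρ - m.φ₀ - m.φ₁ * a n)
    - m.γ₁ * a n - m.γ₀

lemma total_eq_sum_pathSum (a : m.ISP → ℝ) : m.total a = ∑ r, m.pathSum a r :=
  Fintype.sum_prod_type a

lemma pathSum_le_total {a : m.ISP → ℝ} (ha : ∀ n, 0 ≤ a n) (r : Fin m.Q) :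
    m.pathSum a r ≤ m.total a := by
  rw [total_eq_sum_pathSum]
  exact Finset.single_le_sum (f := m.pathSum a)
    (fun r _ => Finset.sum_nonneg fun i _ => ha (r, i)) (Finset.mem_univ r)

lemma le_pathSum {a : m.ISP → ℝ} (ha : ∀ n, 0 ≤ a n) (n : m.ISP) : a n ≤ m.pathSum a n.1 :=
  Finset.single_le_sum (f := fun i => a (n.1, i)) (fun i _ => ha (n.1, i)) (Finset.mem_univ n.2)

lemma le_total {a : m.ISP → ℝ} (ha : ∀ n, 0 ≤ a n) (n : m.ISP) : a n ≤ m.total a :=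
  Finset.single_le_sum (f := a) (fun n _ => ha n) (Finset.mem_univ n)

lemma total_update (a : m.ISP → ℝ) (n : m.ISP) (x : ℝ) :
    m.total (Function.update a n x) = m.total a - a n + x := by
  unfold total
  rw [Finset.sum_update_of_mem (Finset.mem_univ n),
    ← Finset.add_sum_erase _ a (Finset.mem_univ n), Finset.sdiff_singleton_eq_erase]
  ring

lemma pathSum_update (a : m.ISP → ℝ) (n : m.ISP) (x : ℝ) :
    m.pathSum (Function.update a n x) n.1 = m.pathSum a n.1 - a n + x := by
  obtain ⟨r, i⟩ := n
  unfold pathSum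
  have : (fun j => Function.update a (r, i) x (r, j)) = Function.update (fun j => a (r, j)) i x := by
    ext j
    by_cases h : j = i
    · subst h; simp
    · simp [Function.update_of_ne, h]
  simp only [this, Finset.sum_update_of_mem (Finset.mem_univ i)]
  rw [← Finset.add_sum_erase _ (fun j => a (r, j)) (Finset.mem_univ i),
    Finset.sdiff_singleton_eq_erase]
  ring

lemma one_le_Q : (1 : ℝ) ≤ m.Q := by exact_mod_cast m.Q_pos

lemma one_le_I : (1 : ℝ) ≤ m.I := by exact_mod_cast m.I_pos

lemma ratio_nonneg : 0 ≤ m.ratio := div_nonneg m.d_nonneg m.cost_pos.le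

lemma one_le_rest {a : m.ISP → ℝ} (ha : ∀ n, 0 ≤ a n) (r : Fin m.Q) : 1 ≤ m.rest a r := by
  unfold rest
  have h1 := mul_nonneg (sub_nonneg.2 m.one_le_Q) m.α₀_nonneg
  have h2 := mul_nonneg m.α₁_pos.le (sub_nonneg.2 (m.pathSum_le_total ha r))
  linarith

lemma one_le_denom_sub {a : m.ISP → ℝ} (ha : ∀ n, 0 ≤ a n) (n : m.ISP) :
    1 ≤ m.denom a - m.α₁ * a n := by
  unfold denom
  have h1 := mul_nonneg (zero_le_one.trans m.one_le_Q) m.α₀_nonneg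
  have h2 := mul_nonneg m.α₁_pos.le (sub_nonneg.2 (m.le_total ha n))
  linarith

lemma margin_nonneg {a : m.ISP → ℝ} (ha : ∀ n, 0 ≤ a n) (n : m.ISP) : 0 ≤ m.margin a n := by
  have h1 := m.one_le_denom_sub ha n
  have h2 := mul_nonneg m.α₁_pos.le (sub_nonneg.2 m.φ₀_le_ρ)
  unfold margin
  unfold denom at h1
  have h3 := mul_nonneg m.φ₁_nonneg
    (show 0 ≤ 1 + m.Q * m.α₀ + m.α₁ * (m.total a - a n) by linarith)
  linarith

lemma radicand_nonneg {a : m.ISP → ℝ} (ha : ∀ n, 0 ≤ a n) (n : m.ISP) : 0 ≤ m.radicand a n :=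
  mul_nonneg (mul_nonneg m.ratio_nonneg (zero_le_one.trans (m.one_le_rest ha n.1)))
    (m.margin_nonneg ha n)

lemma bestResponse_nonneg (a : m.ISP → ℝ) (n : m.ISP) : 0 ≤ m.bestResponse a n := le_max_left _ _

lemma denom_eq_sum_valuation (A : m.ISP → Fin m.K → ℝ) :
    1 + ∑ r, m.valuation A r = m.denom (m.attributeSum A) := by
  simp only [valuation, denom, total, attributeSum, Finset.sum_add_distrib, Fintype.sum_prod_type,
    Finset.mul_sum, Finset.sum_const, Finset.card_univ, Fintype.card_fin, nsmul_eq_mul]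
  ring

lemma profit_eq_sumProfit (A : m.ISP → Fin m.K → ℝ) (n : m.ISP) :
    m.profit A n = m.sumProfit (m.attributeSum A) n := by
  have hv : m.valuation A n.1 = m.α₁ * m.pathSum (m.attributeSum A) n.1 + m.α₀ := by
    simp only [valuation, pathSum, attributeSum, Finset.mul_sum]
  simp only [profit, demand, selectionProb, denom_eq_sum_valuation, hv, sumProfit,
    ← Finset.mul_sum, attributeSum]
  ring

lemma attributeSum_update (A : m.ISP → Fin m.K → ℝ) (n : m.ISP) (y : Fin m.K → ℝ) :
    m.attributeSum (Function.update A n y) = Function.update (m.attributeSum A) n (∑ k, y k) := by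
  ext n'
  by_cases h : n' = n
  · subst h; simp [attributeSum]
  · simp [attributeSum, Function.update_of_ne h]

/-- On `[b, ∞)`, the function `X + R / X` is minimal at `max b √R` only. -/
lemma add_div_lower_bound {b R X : ℝ} (hb : 0 < b) (hR : 0 ≤ R) (hX : b ≤ X) :
    max b √R + R / max b √R + (X - max b √R) ^ 2 / X ≤ X + R / X := by
  set Y := max b √R with hY
  have hY0 : 0 < Y := hb.trans_le (le_max_left _ _)
  have hX0 : 0 < X := hb.trans_le hX
  have key : 0 ≤ (X - Y) * (Y ^ 2 - R) := by
    rcases _root_.le_total b √R with h | h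
    · have : Y = √R := max_eq_right h
      rw [this, Real.sq_sqrt hR]; simp
    · have : Y = b := max_eq_left h
      rw [this]
      refine mul_nonneg (by linarith) ?_
      have := Real.sq_sqrt hR
      nlinarith [Real.sqrt_nonneg R]
  have : X + R / X - (Y + R / Y + (X - Y) ^ 2 / X) = (X - Y) * (Y ^ 2 - R) / (X * Y) := by
    field_simp; ring
  have h2 : 0 ≤ (X - Y) * (Y ^ 2 - R) / (X * Y) := by positivity
  linarith

/-- With `X` the new denominator, the valuation of the path is `X - rest` and the profit per unit of
demand is `(margin - φ₁ X) / α₁`. Dividing their product by `X` leaves only a constant, a multiple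
of `X` and a multiple of `1 / X`. -/
lemma sumProfit_update (a : m.ISP → ℝ) (ha : ∀ n, 0 ≤ a n) (n : m.ISP) {x : ℝ} (hx : 0 ≤ x) :
    m.sumProfit (Function.update a n x) n =
      m.d * (m.ρ - m.φ₀) - m.γ₀ + m.d * m.rest a n.1 * m.φ₁ / m.α₁
      + (m.d * m.φ₁ + m.γ₁) / m.α₁ * (m.denom a - m.α₁ * a n)
      - (m.d * m.φ₁ + m.γ₁) / m.α₁ * ((m.denom a - m.α₁ * a n + m.α₁ * x)
        + m.radicand a n / (m.denom a - m.α₁ * a n + m.α₁ * x)) := by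
  have hα := m.α₁_pos
  have hX : 0 < m.denom a - m.α₁ * a n + m.α₁ * x := by
    have := m.one_le_denom_sub ha n
    have := mul_nonneg hα.le hx
    linarith
  have hden : m.denom (Function.update a n x) = m.denom a - m.α₁ * a n + m.α₁ * x := by
    simp only [denom, total_update]; ring
  have hk := m.cost_pos
  have hps : m.α₁ * m.pathSum (Function.update a n x) n.1 + m.α₀ =
      m.denom a - m.α₁ * a n + m.α₁ * x - m.rest a n.1 := by
    rw [pathSum_update]; simp only [denom, rest]; ring
  have hM : m.margin a n = m.φ₁ * (m.denom a - m.α₁ * a n) + m.α₁ * (m.ρ - m.φ₀) := by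
    simp only [margin, denom]; ring
  simp only [sumProfit, hden, hps, radicand, hM, ratio, Function.update_self]
  generalize m.rest a n.1 = u at *
  generalize m.denom a - m.α₁ * a n = D at *
  field_simp
  ring

lemma denom_bestResponse (a : m.ISP → ℝ) (n : m.ISP) :
    m.denom a - m.α₁ * a n + m.α₁ * m.bestResponse a n =
      max (m.denom a - m.α₁ * a n) √(m.radicand a n) := by
  have hα := m.α₁_pos
  rw [bestResponse, mul_max_of_nonneg _ _ hα.le, ← max_add_add_left, drift]
  congr 1
  · ring
  · field_simp; ring

/-- The quadratic loss term yields uniqueness of the maximizer along with optimality. -/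
lemma sumProfit_gap (a : m.ISP → ℝ) (ha : ∀ n, 0 ≤ a n) (n : m.ISP) {x : ℝ} (hx : 0 ≤ x) :
    m.sumProfit (Function.update a n x) n + (m.d * m.φ₁ + m.γ₁) / m.α₁ *
      ((m.α₁ * (x - m.bestResponse a n)) ^ 2 / (m.denom a - m.α₁ * a n + m.α₁ * x)) ≤
    m.sumProfit (Function.update a n (m.bestResponse a n)) n := by
  have hα := m.α₁_pos
  have hD := m.one_le_denom_sub ha n
  rw [m.sumProfit_update a ha n hx, m.sumProfit_update a ha n (m.bestResponse_nonneg a n)]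
  have hX : m.denom a - m.α₁ * a n ≤ m.denom a - m.α₁ * a n + m.α₁ * x := by
    have := mul_nonneg hα.le hx
    linarith
  have h := add_div_lower_bound (zero_lt_one.trans_le hD) (m.radicand_nonneg ha n) hX
  rw [← denom_bestResponse] at h
  have hk : 0 ≤ (m.d * m.φ₁ + m.γ₁) / m.α₁ := (div_pos m.cost_pos hα).le
  have h2 := mul_le_mul_of_nonneg_left h hk
  have h3 : m.denom a - m.α₁ * a n + m.α₁ * x -
      (m.denom a - m.α₁ * a n + m.α₁ * m.bestResponse a n) =
      m.α₁ * (x - m.bestResponse a n) := by ring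
  rw [h3] at h2
  linarith

lemma isOptimal_iff (A : m.ISP → Fin m.K → ℝ) (hA : ∀ n k, 0 ≤ A n k) (n : m.ISP)
    (x : Fin m.K → ℝ) :
    m.IsOptimal A n x ↔ (∀ k, 0 ≤ x k) ∧ ∑ k, x k = m.bestResponse (m.attributeSum A) n := by
  have ha : ∀ n, 0 ≤ m.attributeSum A n := fun n => Finset.sum_nonneg fun k _ => hA n k
  have hα := m.α₁_pos
  set b := m.bestResponse (m.attributeSum A) n
  have hden : ∀ x : ℝ, 0 ≤ x → 0 < m.denom (m.attributeSum A) - m.α₁ * m.attributeSum A n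
      + m.α₁ * x := fun x hx => by
    have := m.one_le_denom_sub ha n
    have := mul_nonneg hα.le hx
    linarith
  have hk : 0 < (m.d * m.φ₁ + m.γ₁) / m.α₁ := div_pos m.cost_pos hα
  simp only [IsOptimal, profit_eq_sumProfit, attributeSum_update]
  refine and_congr_right fun hx => ⟨fun h => ?_, fun h y hy => ?_⟩
  · have hx0 : 0 ≤ ∑ k, x k := Finset.sum_nonneg fun k _ => hx k
    -- Only sums matter, so the competing vector may put the whole best response on one attribute.
    have h1 := h (Pi.single ⟨0, m.K_pos⟩ b)
      (fun k => (Pi.single_nonneg.2 (m.bestResponse_nonneg _ n) : (0 : Fin m.K → ℝ) ≤ _) k)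
    rw [Finset.sum_pi_single'] at h1
    simp only [Finset.mem_univ, if_true] at h1
    have h2 := m.sumProfit_gap _ ha n hx0
    by_contra hne
    have h3 : 0 < (m.α₁ * (∑ k, x k - b)) ^ 2 := by
      have := sub_ne_zero.2 hne
      positivity
    have h4 := mul_pos hk (div_pos h3 (hden _ hx0))
    linarith
  · have hy0 : 0 ≤ ∑ k, y k := Finset.sum_nonneg fun k _ => hy k
    have h2 := m.sumProfit_gap _ ha n hy0
    have h4 := mul_nonneg hk.le (div_nonneg (sq_nonneg (m.α₁ * (∑ k, y k - b))) (hden _ hy0).le)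
    rw [h]
    linarith

lemma isBestResponse_iff {a : m.ISP → ℝ} (ha : ∀ n, 0 ≤ a n) (n : m.ISP) (b : ℝ) :
    m.IsBestResponse a n b ↔ b = m.bestResponse a n := by
  have single_nonneg : ∀ {x : ℝ}, 0 ≤ x → ∀ k, 0 ≤ (Pi.single ⟨0, m.K_pos⟩ x : Fin m.K → ℝ) k :=
    fun hx => (Pi.single_nonneg.2 hx : (0 : Fin m.K → ℝ) ≤ _)
  constructor
  · rintro ⟨A, hA, rfl, x, hx, rfl⟩
    exact ((m.isOptimal_iff A hA n x).1 hx).2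
  · rintro rfl
    have hA : m.attributeSum (fun n => Pi.single ⟨0, m.K_pos⟩ (a n)) = a := by
      ext n'
      simp only [attributeSum]
      rw [Finset.sum_pi_single']
      simp
    have hA0 : ∀ n' k, 0 ≤ (fun n => (Pi.single ⟨0, m.K_pos⟩ (a n) : Fin m.K → ℝ)) n' k :=
      fun n' => single_nonneg (ha n')
    have hs : ∑ k, (Pi.single ⟨0, m.K_pos⟩ (m.bestResponse a n) : Fin m.K → ℝ) k
        = m.bestResponse a n := by
      rw [Finset.sum_pi_single']; simp
    refine ⟨_, hA0, hA, _, (m.isOptimal_iff _ hA0 n _).2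
      ⟨single_nonneg (m.bestResponse_nonneg a n), ?_⟩, hs⟩
    rw [hA, hs]

/-- The vector field of the competition dynamics. -/
def field (a : m.ISP → ℝ) : m.ISP → ℝ := fun n => m.bestResponse a n - a n

lemma isSolution_iff (a : ℝ → m.ISP → ℝ) :
    m.IsSolution a ↔ ∀ t, 0 ≤ t → (∀ n, 0 ≤ a t n) ∧
      HasDerivWithinAt a (m.field (a t)) (Set.Ici 0) t := by
  refine forall₂_congr fun t ht => ?_
  rw [hasDerivWithinAt_pi]
  constructor
  · intro h
    refine ⟨fun n => (h n).1, fun n => ?_⟩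
    obtain ⟨b, hb, hd⟩ := (h n).2
    rw [isBestResponse_iff _ (fun n => (h n).1)] at hb
    subst hb
    exact hd
  · rintro ⟨h1, h2⟩ n
    exact ⟨h1 n, _, (m.isBestResponse_iff h1 n _).2 rfl, h2 n⟩

lemma isEquilibrium_iff (e : m.ISP → ℝ) :
    m.IsEquilibrium e ↔ (∀ n, 0 ≤ e n) ∧ ∀ n, m.bestResponse e n = e n := by
  rw [IsEquilibrium, isSolution_iff]
  constructor
  · intro h
    refine ⟨(h 0 le_rfl).1, fun n => ?_⟩
    have h1 := (h 0 le_rfl).2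
    have h2 := (uniqueDiffOn_Ici (0 : ℝ) 0 Set.self_mem_Ici).eq_deriv _ h1
      (hasDerivWithinAt_const _ _ _)
    have := congrFun h2 n
    simp only [field, Pi.zero_apply] at this
    linarith
  · rintro ⟨h1, h2⟩ t _
    have : m.field e = 0 := by ext n; simp [field, h2 n]
    exact ⟨h1, this ▸ hasDerivWithinAt_const _ _ _⟩

lemma isNash_iff (A : m.ISP → Fin m.K → ℝ) (hA : ∀ n k, 0 ≤ A n k) :
    m.IsNash A ↔ ∀ n, m.bestResponse (m.attributeSum A) n = m.attributeSum A n := by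
  simp only [IsNash, m.isOptimal_iff A hA]
  exact forall_congr' fun n => ⟨fun h => h.2.symm, fun h => ⟨hA n, h.symm⟩⟩

end HomogeneousMarket

end

noncomputable section

/-! ### Global forward solutions by Picard–Lindelöf -/

section Existence

variable {E : Type*} [NormedAddCommGroup E] [NormedSpace ℝ E]

/-- The field of `y = exp t • a`, where `a' = b a - a`. -/
def twistedField (b : E → E) (t : ℝ) (y : E) : E := Real.exp t • b (Real.exp (-t) • y)

/-- The factors `exp t` and `exp (-t)` cancel, so the constant is uniform in time. -/
lemma lipschitzWith_twistedField {b : E → E} {K : NNReal} (hb : LipschitzWith K b) (t : ℝ) :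
    LipschitzWith K (twistedField b t) := by
  refine LipschitzWith.of_dist_le_mul fun x y => ?_
  have h1 := hb.dist_le_mul (Real.exp (-t) • x) (Real.exp (-t) • y)
  rw [dist_smul₀, Real.norm_of_nonneg (Real.exp_pos _).le] at h1
  unfold twistedField
  rw [dist_smul₀, Real.norm_of_nonneg (Real.exp_pos _).le]
  calc _ ≤ Real.exp t * (K * (Real.exp (-t) * dist x y)) := by gcongr
    _ = K * dist x y * (Real.exp t * Real.exp (-t)) := by ring
    _ = K * dist x y := by rw [← Real.exp_add]; simp

variable [CompleteSpace E]

/-- The field `b a - a` is unbounded. After the twist, the field is bounded by `exp T * B` on the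
whole space for times in `[0, T]`, so a ball of radius `exp T * B * T` suffices for the full
interval. -/
lemma exists_twisted_Icc {b : E → E} {K : NNReal} (hb : LipschitzWith K b) {B : NNReal}
    (hB : ∀ x, ‖b x‖ ≤ B) (x : E) {T : ℝ} (hT : 0 ≤ T) :
    ∃ y : ℝ → E, y 0 = x ∧ ∀ t ∈ Set.Icc 0 T,
      HasDerivWithinAt y (twistedField b t (y t)) (Set.Icc 0 T) t := by
  have hP : IsPicardLindelof (twistedField b) (tmin := 0) (tmax := T) ⟨0, le_rfl, hT⟩ x
      (Real.toNNReal (Real.exp T * B) * Real.toNNReal T) 0 (Real.toNNReal (Real.exp T * B)) K := by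
    refine ⟨fun t _ => (lipschitzWith_twistedField hb t).lipschitzOnWith, fun z _ => ?_,
      fun t ht z _ => ?_, ?_⟩
    · unfold twistedField
      have := hb.continuous
      fun_prop
    · rw [Real.coe_toNNReal _ (by positivity), twistedField, norm_smul,
        Real.norm_of_nonneg (Real.exp_pos _).le]
      exact mul_le_mul (Real.exp_le_exp.2 ht.2) (hB _) (norm_nonneg _) (Real.exp_pos _).le
    · simp [hT]
  exact hP.exists_eq_forall_mem_Icc_hasDerivWithinAt₀

lemma exists_twisted {b : E → E} {K : NNReal} (hb : LipschitzWith K b) {B : NNReal}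
    (hB : ∀ x, ‖b x‖ ≤ B) (x : E) :
    ∃ y : ℝ → E, y 0 = x ∧ ∀ t, 0 ≤ t →
      HasDerivWithinAt y (twistedField b t (y t)) (Set.Ici 0) t := by
  choose y hy0 hy using fun n : ℕ => exists_twisted_Icc hb hB x (T := (n : ℝ) + 1) (by positivity)
  have hder : ∀ (n : ℕ) (t : ℝ), 0 ≤ t → t < n + 1 →
      HasDerivWithinAt (y n) (twistedField b t (y n t)) (Set.Ici 0) t := by
    intro n t h0 h1
    refine (hy n t ⟨h0, h1.le⟩).mono_of_mem_nhdsWithin ?_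
    rw [← Set.Ici_inter_Iic]
    exact inter_mem_nhdsWithin _ (Iic_mem_nhds h1)
  have huniq : ∀ (k n : ℕ), k ≤ n → Set.EqOn (y k) (y n) (Set.Icc 0 (k + 1)) := by
    intro k n hkn
    have hkn' : (k : ℝ) ≤ n := by exact_mod_cast hkn
    refine ODE_solution_unique (v := twistedField b) (lipschitzWith_twistedField hb)
      (fun t ht => (hy k t ht).continuousWithinAt) (fun t ht => ?_)
      (fun t ht => ?_) (fun t ht => ?_) (by rw [hy0, hy0])
    · exact (hder k t ht.1 ht.2).mono (Set.Ici_subset_Ici.2 ht.1)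
    · exact ((hy n t ⟨ht.1, ht.2.trans (by linarith)⟩).continuousWithinAt).mono
        (Set.Icc_subset_Icc_right (by linarith))
    · exact (hder n t ht.1 (ht.2.trans_le (by linarith))).mono (Set.Ici_subset_Ici.2 ht.1)
  -- At time `t` the solution on `[0, ⌊t⌋₊ + 1]` is used. This interval extends strictly beyond `t`,
  -- and uniqueness identifies the pieces for nearby times.
  refine ⟨fun t => y ⌊t⌋₊ t, by simp [hy0], fun t ht => ?_⟩
  refine (hder ⌊t⌋₊ t ht (Nat.lt_floor_add_one t)).congr_of_eventuallyEq ?_ rfl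
  have : Set.Iio ((⌊t⌋₊ : ℝ) + 1) ∈ 𝓝[Set.Ici 0] t :=
    nhdsWithin_le_nhds (Iio_mem_nhds (Nat.lt_floor_add_one t))
  filter_upwards [this, self_mem_nhdsWithin] with s hs hs0
  have hs0 : 0 ≤ s := hs0
  refine huniq _ _ ?_ ⟨hs0, (Nat.lt_floor_add_one s).le⟩
  have : ⌊s⌋₊ < ⌊t⌋₊ + 1 := (Nat.floor_lt hs0).2 (by exact_mod_cast hs)
  omega

/-- Global forward solutions of `a' = b a - a` for bounded Lipschitz `b`. -/
theorem exists_forward_solution {b : E → E} {K : NNReal} (hb : LipschitzWith K b) {B : NNReal}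
    (hB : ∀ x, ‖b x‖ ≤ B) (x : E) :
    ∃ a : ℝ → E, a 0 = x ∧ ∀ t, 0 ≤ t → HasDerivWithinAt a (b (a t) - a t) (Set.Ici 0) t := by
  obtain ⟨y, hy0, hy⟩ := exists_twisted hb hB x
  refine ⟨fun t => Real.exp (-t) • y t, by simp [hy0], fun t ht => ?_⟩
  have he : HasDerivWithinAt (fun t : ℝ => Real.exp (-t)) (-Real.exp (-t)) (Set.Ici 0) t := by
    simpa using ((hasDerivAt_neg t).exp).hasDerivWithinAt
  refine HasDerivWithinAt.congr_deriv (he.smul (hy t ht)) ?_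
  rw [twistedField, smul_smul, ← Real.exp_add]
  simp only [neg_add_cancel, Real.exp_zero, one_smul, neg_smul]
  abel

end Existence

/-! ### Differential inequalities and trapping -/

lemma antitoneOn_Icc_of_hasDerivWithinAt_nonpos {f f' : ℝ → ℝ} {T : ℝ}
    (hc : ContinuousOn f (Set.Icc 0 T))
    (hd : ∀ t, 0 ≤ t → t < T → HasDerivWithinAt f (f' t) (Set.Ici 0) t)
    (hf : ∀ t, 0 ≤ t → t < T → f' t ≤ 0) : AntitoneOn f (Set.Icc 0 T) := by
  refine antitoneOn_of_hasDerivWithinAt_nonpos (f' := f') (convex_Icc 0 T) hc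
    (fun t ht => ?_) (fun t ht => ?_)
  all_goals rw [interior_Icc] at *
  · exact (hd t ht.1.le ht.2).mono (Set.Ioo_subset_Icc_self.trans Set.Icc_subset_Ici_self)
  · exact hf t ht.1.le ht.2

/-- Exponential decay from a differential inequality. -/
lemma le_mul_exp_of_hasDerivWithinAt {v v' : ℝ → ℝ} {s : ℝ}
    (hd : ∀ t, 0 ≤ t → HasDerivWithinAt v (v' t) (Set.Ici 0) t)
    (hv : ∀ t, 0 ≤ t → v' t ≤ -(s * v t)) {t : ℝ} (ht : 0 ≤ t) :
    v t ≤ v 0 * Real.exp (-(s * t)) := by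
  have hd' : ∀ t, 0 ≤ t → HasDerivWithinAt (fun t => Real.exp (s * t) * v t)
      (Real.exp (s * t) * (s * v t + v' t)) (Set.Ici 0) t := fun t ht => by
    have he : HasDerivWithinAt (fun t : ℝ => Real.exp (s * t)) (Real.exp (s * t) * s)
      (Set.Ici 0) t := by
      simpa using (((hasDerivAt_id t).const_mul s).exp).hasDerivWithinAt
    refine HasDerivWithinAt.congr_deriv (he.mul (hd t ht)) ?_
    ring
  have h := antitoneOn_Icc_of_hasDerivWithinAt_nonpos (T := t)
    (fun r hr => ((hd' r hr.1).continuousWithinAt).mono Set.Icc_subset_Ici_self)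
    (fun r hr _ => hd' r hr)
    (fun r hr _ => mul_nonpos_of_nonneg_of_nonpos (Real.exp_pos _).le (by linarith [hv r hr]))
    (Set.left_mem_Icc.2 ht) (Set.right_mem_Icc.2 ht) ht
  simp only [mul_zero, Real.exp_zero, one_mul] at h
  calc v t = Real.exp (s * t) * v t * Real.exp (-(s * t)) := by
        rw [mul_right_comm, ← Real.exp_add]; simp
    _ ≤ _ := by gcongr

/-- A curve with `a' ≥ -a` stays nonnegative. -/
lemma nonneg_of_hasDerivWithinAt {v β : ℝ → ℝ}
    (hd : ∀ t, 0 ≤ t → HasDerivWithinAt v (β t - v t) (Set.Ici 0) t)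
    (hβ : ∀ t, 0 ≤ β t) (h0 : 0 ≤ v 0) {t : ℝ} (ht : 0 ≤ t) : 0 ≤ v t := by
  have h := le_mul_exp_of_hasDerivWithinAt (v := fun t => -v t) (v' := fun t => -(β t - v t))
    (s := 1) (fun t ht => (hd t ht).neg) (fun t _ => by linarith [hβ t]) ht
  have := mul_nonneg h0 (Real.exp_pos (-(1 * t))).le
  linarith

/-- A curve cannot leave a ball on which a Lyapunov function decreases. -/
lemma norm_lt_of_lyapunov {E : Type*} [NormedAddCommGroup E] {w : ℝ → E} {v v' : ℝ → ℝ}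
    {l ε : ℝ} (hl : 0 < l) (hw : ContinuousOn w (Set.Ici 0))
    (hc : ContinuousOn v (Set.Ici 0))
    (hv : ∀ t, 0 ≤ t → ‖w t‖ < ε → HasDerivWithinAt v (v' t) (Set.Ici 0) t ∧ v' t ≤ 0)
    (hle : ∀ t, 0 ≤ t → ‖w t‖ ≤ ε → l * ‖w t‖ ^ 2 ≤ v t) (h0 : v 0 < l * ε ^ 2)
    (hw0 : ‖w 0‖ < ε) {t : ℝ} (ht : 0 ≤ t) : ‖w t‖ < ε := by
  by_contra hcon
  push Not at hcon
  have hcn : ContinuousOn (fun t => ‖w t‖) (Set.Icc 0 t) := (hw.mono Set.Icc_subset_Ici_self).norm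
  set S : Set ℝ := Set.Icc 0 t ∩ (fun t => ‖w t‖) ⁻¹' Set.Ici ε with hS
  have hSc : IsClosed S := hcn.preimage_isClosed_of_isClosed isClosed_Icc isClosed_Ici
  have hSn : S.Nonempty := ⟨t, ⟨ht, le_rfl⟩, hcon⟩
  have hSb : BddBelow S := ⟨0, fun x hx => hx.1.1⟩
  -- The first exit time from the open ball, attained because `S` is closed.
  set T := sInf S with hT
  have hTS : T ∈ S := hSc.csInf_mem hSn hSb
  have hlt : ∀ r, 0 ≤ r → r < T → ‖w r‖ < ε := fun r hr hrT => by
    by_contra h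
    push Not at h
    exact absurd (csInf_le hSb (show r ∈ S from ⟨⟨hr, hrT.le.trans hTS.1.2⟩, h⟩)) (not_le.2 hrT)
  have hT0 : 0 ≤ T := hTS.1.1
  have hTpos : 0 < T := by
    rcases hT0.eq_or_lt with h | h
    · have := hTS.2
      rw [← h] at this
      exact absurd hw0 (not_lt.2 this)
    · exact h
  -- By continuity from the left the norm at `T` does not exceed `ε`, so the lower bound `hle` is
  -- still available at the exit time.
  have hTe : ‖w T‖ ≤ ε := by
    have hcT : ContinuousWithinAt (fun t => ‖w t‖) (Set.Iio T) T := by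
      refine (hcn T hTS.1).mono_of_mem_nhdsWithin ?_
      filter_upwards [self_mem_nhdsWithin, nhdsWithin_le_nhds (Ioi_mem_nhds hTpos)] with r h1 h2
      exact ⟨le_of_lt h2, (le_of_lt h1).trans hTS.1.2⟩
    refine le_of_tendsto hcT.tendsto ?_
    filter_upwards [self_mem_nhdsWithin, nhdsWithin_le_nhds (Ioi_mem_nhds hTpos)] with r h1 h2
    exact (hlt r (le_of_lt h2) h1).le
  have hanti := antitoneOn_Icc_of_hasDerivWithinAt_nonpos (T := T)
    (hc.mono Set.Icc_subset_Ici_self)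
    (fun r hr hrT => (hv r hr (hlt r hr hrT)).1) (fun r hr hrT => (hv r hr (hlt r hr hrT)).2)
    (Set.left_mem_Icc.2 hT0) (Set.right_mem_Icc.2 hT0) hT0
  have h1 := hle T hT0 hTe
  have h2 : ε ≤ ‖w T‖ := hTS.2
  have h3 : ε ^ 2 ≤ ‖w T‖ ^ 2 := by
    have := (norm_nonneg (w 0)).trans_lt hw0
    gcongr
  nlinarith

end

/-! ### Lyapunov functions and stability -/

noncomputable section

/-- The nearest-point retraction of `ι → ℝ` onto the cube of radius `ε` around `e`. -/
def clampCube {ι : Type*} (e : ι → ℝ) (ε : ℝ) (a : ι → ℝ) : ι → ℝ :=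
  fun n => max (e n - ε) (min (e n + ε) (a n))

section

variable {ι : Type*} [Fintype ι]

lemma lipschitzWith_clampCube (e : ι → ℝ) (ε : ℝ) : LipschitzWith 1 (clampCube e ε) := by
  refine LipschitzWith.of_dist_le_mul fun x y => ?_
  rw [NNReal.coe_one, one_mul, dist_pi_le_iff dist_nonneg]
  intro n
  have h := ((LipschitzWith.id (α := ℝ)).const_min (e n + ε)).const_max (e n - ε)
  refine (h.dist_le_mul (x n) (y n)).trans ?_
  rw [NNReal.coe_one, one_mul]
  exact dist_le_pi_dist x y n

lemma clampCube_mem (e : ι → ℝ) {ε : ℝ} (hε : 0 ≤ ε) (a : ι → ℝ) :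
    clampCube e ε a ∈ Metric.closedBall e ε := by
  rw [Metric.mem_closedBall, dist_pi_le_iff hε]
  intro n
  rw [Real.dist_eq, abs_le]
  have h1 : e n - ε ≤ clampCube e ε a n := le_max_left _ _
  have h2 : clampCube e ε a n ≤ e n + ε := max_le (by linarith) (min_le_left _ _)
  constructor <;> linarith

lemma clampCube_eq_self {e a : ι → ℝ} {ε : ℝ} (h : ‖a - e‖ ≤ ε) : clampCube e ε a = a := by
  ext n
  have h1 := (norm_le_pi_norm (a - e) n).trans h
  rw [Pi.sub_apply, Real.norm_eq_abs, abs_le] at h1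
  rw [clampCube, min_eq_right (by linarith), max_eq_right (by linarith)]

end

namespace HomogeneousMarket

variable (m : HomogeneousMarket)

/-- A Lyapunov function for the competition dynamics near `e`, with derivative `V'`, whose decay
along the vector field is bounded by `W`. -/
structure IsLyapunovFunction (e : m.ISP → ℝ) (V : (m.ISP → ℝ) → ℝ)
    (V' : (m.ISP → ℝ) → (m.ISP → ℝ) → ℝ) (W : (m.ISP → ℝ) → ℝ) (l ε : ℝ) : Prop where
  l_pos : 0 < l
  ε_pos : 0 < ε
  continuous : Continuous V
  apply_self : V e = 0
  hasDeriv : ∀ (a : ℝ → m.ISP → ℝ) (x : m.ISP → ℝ) (s : Set ℝ) (t : ℝ),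
    HasDerivWithinAt a x s t → HasDerivWithinAt (fun t => V (a t)) (V' (a t) x) s t
  le_apply : ∀ a : m.ISP → ℝ, (∀ n, 0 ≤ a n) → ‖a - e‖ < ε → l * ‖a - e‖ ^ 2 ≤ V a
  deriv_le : ∀ a : m.ISP → ℝ, (∀ n, 0 ≤ a n) → ‖a - e‖ < ε → V' a (m.field a) ≤ W a
  W_nonpos : ∀ a : m.ISP → ℝ, (∀ n, 0 ≤ a n) → ‖a - e‖ < ε → W a ≤ 0

section Stability

variable {m}

/-- The curve need only follow the field while inside the ball. This makes the lemma applicable to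
solutions of a modified equation, which is how existence is obtained. -/
lemma IsLyapunovFunction.trapping {e : m.ISP → ℝ} {V V' W} {l ε : ℝ}
    (h : m.IsLyapunovFunction e V V' W l ε) {ε₁ : ℝ} (hε₁ : 0 < ε₁) (hlt : ε₁ < ε) :
    ∃ δ > 0, ∀ a : ℝ → m.ISP → ℝ, ContinuousOn a (Set.Ici 0) → (∀ t, 0 ≤ t → ∀ n, 0 ≤ a t n) →
      (∀ t, 0 ≤ t → ‖a t - e‖ < ε₁ → HasDerivWithinAt a (m.field (a t)) (Set.Ici 0) t) →
      ‖a 0 - e‖ < δ → ∀ t, 0 ≤ t → ‖a t - e‖ < ε₁ := by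
  have hc : ∀ᶠ x in 𝓝 e, V x < l * ε₁ ^ 2 := by
    refine h.continuous.continuousAt.eventually_lt continuousAt_const ?_
    rw [h.apply_self]
    have := h.l_pos
    positivity
  obtain ⟨δ, hδ, hball⟩ := Metric.eventually_nhds_iff.1 hc
  refine ⟨min δ ε₁, lt_min hδ hε₁, fun a hac ha0 had h0 t ht => ?_⟩
  refine norm_lt_of_lyapunov (w := fun t => a t - e) (v := fun t => V (a t))
    (v' := fun t => V' (a t) (m.field (a t))) h.l_pos (hac.sub continuousOn_const)
    (h.continuous.comp_continuousOn hac) (fun t ht hte => ⟨h.hasDeriv _ _ _ _ (had t ht hte), ?_⟩)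
    (fun t ht hte => h.le_apply _ (ha0 t ht) (hte.trans_lt hlt)) ?_
    (h0.trans_le (min_le_right _ _)) ht
  · exact (h.deriv_le _ (ha0 t ht) (hte.trans hlt)).trans (h.W_nonpos _ (ha0 t ht) (hte.trans hlt))
  · exact hball (by rw [dist_eq_norm]; exact h0.trans_le (min_le_left _ _))

/-- Precomposing the best response with `clampCube` makes it bounded and globally Lipschitz, so a
global solution exists. Trapping keeps that solution in the region where the clamp is the identity,
so it solves the original dynamics. -/
lemma IsLyapunovFunction.isLyapunovStable {e : m.ISP → ℝ} {V V' W} {l ε : ℝ}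
    (h : m.IsLyapunovFunction e V V' W l ε)
    (hLip : ∃ K, ∃ s ∈ 𝓝 e, LipschitzOnWith K m.bestResponse s) : m.IsLyapunovStable e := by
  intro ε₀ hε₀
  obtain ⟨K, s, hs, hK⟩ := hLip
  obtain ⟨ρ, hρ, hρs⟩ := Metric.nhds_basis_closedBall.mem_iff.1 hs
  set ε₁ := min (min ε₀ (ε / 2)) ρ with hε₁
  have h1 : 0 < ε₁ := lt_min (lt_min hε₀ (half_pos h.ε_pos)) hρ
  have h2 : ε₁ < ε :=
    ((min_le_left _ _).trans (min_le_right _ _)).trans_lt (half_lt_self h.ε_pos)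
  obtain ⟨δ, hδ, htrap⟩ := h.trapping h1 h2
  refine ⟨δ, hδ, fun x hx hxe => ⟨?_, fun a ha ha0 t ht => ?_⟩⟩
  · have hmem : ∀ a, clampCube e ε₁ a ∈ s := fun a =>
      hρs (Metric.closedBall_subset_closedBall (min_le_right _ _) (clampCube_mem e h1.le a))
    have hb : LipschitzWith (K * 1) (m.bestResponse ∘ clampCube e ε₁) :=
      lipschitzOnWith_univ.1 (hK.comp (lipschitzWith_clampCube e ε₁).lipschitzOnWith
        (fun a _ => hmem a))
    have hB : ∀ a, ‖(m.bestResponse ∘ clampCube e ε₁) a‖ ≤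
        (K * ε₁.toNNReal + ‖m.bestResponse e‖₊ : NNReal) := fun a => by
      have h3 := hK.dist_le_mul _ (hmem a) e (mem_of_mem_nhds hs)
      have h4 := Metric.mem_closedBall.1 (clampCube_mem e h1.le a)
      have h5 := norm_le_norm_add_norm_sub' (m.bestResponse (clampCube e ε₁ a)) (m.bestResponse e)
      rw [← dist_eq_norm] at h5
      have h6 := mul_le_mul_of_nonneg_left h4 K.coe_nonneg
      push_cast
      rw [Real.coe_toNNReal _ h1.le, Function.comp_apply]
      linarith
    obtain ⟨a, ha0, ha⟩ := exists_forward_solution hb hB x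
    have hnn : ∀ t, 0 ≤ t → ∀ n, 0 ≤ a t n := fun t ht n =>
      nonneg_of_hasDerivWithinAt (v := fun t => a t n)
        (β := fun t => m.bestResponse (clampCube e ε₁ (a t)) n)
        (fun t ht => hasDerivWithinAt_pi.1 (ha t ht) n) (fun t => m.bestResponse_nonneg _ n)
        (by rw [ha0]; exact hx n) ht
    have hfield : ∀ t, 0 ≤ t → ‖a t - e‖ < ε₁ →
        HasDerivWithinAt a (m.field (a t)) (Set.Ici 0) t := fun t ht hte => by
      have h3 := ha t ht
      rw [Function.comp_apply, clampCube_eq_self hte.le] at h3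
      exact h3
    have htr := htrap a (fun t ht => (ha t ht).continuousWithinAt) hnn hfield
      (by rw [ha0, ← dist_eq_norm]; exact hxe)
    exact ⟨a, (m.isSolution_iff a).2 fun t ht => ⟨hnn t ht, hfield t ht (htr t ht)⟩, ha0⟩
  · rw [isSolution_iff] at ha
    rw [dist_eq_norm]
    refine (htrap a (fun t ht => (ha t ht).2.continuousWithinAt) (fun t ht => (ha t ht).1)
      (fun t ht _ => (ha t ht).2) (by rw [ha0, ← dist_eq_norm]; exact hxe) t ht).trans_le ?_
    exact (min_le_left _ _).trans (min_le_left _ _)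

/-- Solutions that start close enough to `e` stay where the Lyapunov function controls them. -/
lemma IsLyapunovFunction.exists_mem_ball {e : m.ISP → ℝ} {V V' W} {l ε : ℝ}
    (h : m.IsLyapunovFunction e V V' W l ε) {ε₁ : ℝ} (hε₁ : 0 < ε₁) (hlt : ε₁ < ε) :
    ∃ δ > 0, ∀ a, m.IsSolution a → dist (a 0) e < δ → ∀ t, 0 ≤ t → ‖a t - e‖ < ε₁ := by
  obtain ⟨δ, hδ, htrap⟩ := h.trapping hε₁ hlt
  refine ⟨δ, hδ, fun a ha h0 => ?_⟩
  rw [isSolution_iff] at ha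
  rw [dist_eq_norm] at h0
  exact htrap a (fun t ht => (ha t ht).2.continuousWithinAt) (fun t ht => (ha t ht).1)
      (fun t ht _ => (ha t ht).2) h0

lemma tendsto_mul_exp_neg_atTop (c : ℝ) {s : ℝ} (hs : 0 < s) :
    Tendsto (fun t => c * Real.exp (-(s * t))) atTop (𝓝 0) := by
  have : Tendsto (fun t : ℝ => s * t) atTop atTop := tendsto_id.const_mul_atTop hs
  simpa using (Real.tendsto_exp_neg_atTop_nhds_zero.comp this).const_mul c

lemma IsLyapunovFunction.isAsymptoticallyStable {e : m.ISP → ℝ} {V V'} {l ε s : ℝ} (hs : 0 < s)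
    (h : m.IsLyapunovFunction e V V' (fun a => -(s * V a)) l ε)
    (hLip : ∃ K, ∃ s ∈ 𝓝 e, LipschitzOnWith K m.bestResponse s) :
    m.IsAsymptoticallyStable e := by
  refine ⟨h.isLyapunovStable hLip, ?_⟩
  obtain ⟨δ, hδ, hmem⟩ := h.exists_mem_ball (half_pos h.ε_pos) (half_lt_self h.ε_pos)
  refine ⟨δ, hδ, fun a ha h0 => ?_⟩
  have hlt : ∀ t, 0 ≤ t → ‖a t - e‖ < ε := fun t ht =>
    (hmem a ha h0 t ht).trans (half_lt_self h.ε_pos)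
  rw [isSolution_iff] at ha
  have hdecay : ∀ t, 0 ≤ t → V (a t) ≤ V (a 0) * Real.exp (-(s * t)) := fun t ht =>
    le_mul_exp_of_hasDerivWithinAt (v := fun t => V (a t))
      (fun t ht => h.hasDeriv _ _ _ _ (ha t ht).2)
      (fun t ht => h.deriv_le _ (ha t ht).1 (hlt t ht)) ht
  rw [tendsto_iff_norm_sub_tendsto_zero]
  have hsq : Tendsto (fun t => ‖a t - e‖ ^ 2) atTop (𝓝 0) := by
    refine squeeze_zero' (g := fun t => V (a 0) / l * Real.exp (-(s * t)))
      (Eventually.of_forall fun t => sq_nonneg _) ?_ (tendsto_mul_exp_neg_atTop _ hs)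
    filter_upwards [eventually_ge_atTop 0] with t ht
    have h1 := (h.le_apply _ (ha t ht).1 (hlt t ht)).trans (hdecay t ht)
    rw [div_mul_eq_mul_div, le_div_iff₀ h.l_pos]
    linarith
  simpa [Real.sqrt_sq (norm_nonneg _)] using hsq.sqrt

end Stability

/-! ### Quadratic forms and their decay under the projected drift -/

/-- The linear map `w ↦ θ w_n + η W_r - q W` of the attribute, its path sum and the total. -/
def linForm (θ η q : ℝ) (w : m.ISP → ℝ) (n : m.ISP) : ℝ :=
  θ * w n + η * m.pathSum w n.1 - q * m.total w

/-- The quadratic form `(θ ∑ w_n ^ 2 + η ∑ W_r ^ 2 - q W ^ 2) / 2`. -/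
def quadForm (θ η q : ℝ) (w : m.ISP → ℝ) : ℝ := (∑ n, m.linForm θ η q w n * w n) / 2

lemma quadForm_eq (θ η q : ℝ) (w : m.ISP → ℝ) :
    2 * m.quadForm θ η q w =
      θ * ∑ n, w n ^ 2 + η * ∑ r, m.pathSum w r ^ 2 - q * m.total w ^ 2 := by
  have h1 : ∑ r, m.pathSum w r ^ 2 = ∑ n : m.ISP, m.pathSum w n.1 * w n := by
    rw [Fintype.sum_prod_type]
    refine Finset.sum_congr rfl fun r _ => ?_
    rw [sq]
    exact Finset.mul_sum _ _ _
  have h2 : m.total w ^ 2 = ∑ n : m.ISP, m.total w * w n := by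
    rw [← Finset.mul_sum, sq]; rfl
  rw [h1, h2, quadForm, Finset.mul_sum, Finset.mul_sum, Finset.mul_sum, ← Finset.sum_add_distrib,
    ← Finset.sum_sub_distrib, mul_div_cancel₀ _ two_ne_zero]
  refine Finset.sum_congr rfl fun n _ => ?_
  rw [linForm]; ring

lemma pathSum_sub (a b : m.ISP → ℝ) (r : Fin m.Q) :
    m.pathSum (a - b) r = m.pathSum a r - m.pathSum b r := by
  simp [pathSum, Finset.sum_sub_distrib]

/-- By this symmetry `linForm` is the gradient of `quadForm`. -/
lemma sum_linForm_mul_comm (θ η q : ℝ) (w x : m.ISP → ℝ) :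
    ∑ n, m.linForm θ η q w n * x n = ∑ n, m.linForm θ η q x n * w n := by
  have h1 : ∀ w x : m.ISP → ℝ, ∑ n : m.ISP, m.pathSum w n.1 * x n =
      ∑ r, m.pathSum w r * m.pathSum x r := fun w x => by
    rw [Fintype.sum_prod_type]
    exact Finset.sum_congr rfl fun r _ => (Finset.mul_sum Finset.univ (fun i => x (r, i)) (m.pathSum w r)).symm
  have h2 : ∀ w x : m.ISP → ℝ, ∑ n, m.linForm θ η q w n * x n =
      θ * ∑ n, w n * x n + η * ∑ r, m.pathSum w r * m.pathSum x r - q * (m.total w * m.total x) :=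
    fun w x => by
    rw [← h1, total.eq_1 m x, Finset.mul_sum, Finset.mul_sum, Finset.mul_sum, Finset.mul_sum,
      ← Finset.sum_add_distrib, ← Finset.sum_sub_distrib]
    exact Finset.sum_congr rfl fun n _ => by rw [linForm]; ring
  rw [h2, h2]
  simp only [mul_comm]

lemma continuous_quadForm (θ η q : ℝ) : Continuous (m.quadForm θ η q) := by
  unfold quadForm linForm pathSum total
  fun_prop

lemma hasDerivWithinAt_quadForm (θ η q : ℝ) (e : m.ISP → ℝ) (a : ℝ → m.ISP → ℝ)
    (x : m.ISP → ℝ) (s : Set ℝ) (t : ℝ) (h : HasDerivWithinAt a x s t) :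
    HasDerivWithinAt (fun t => m.quadForm θ η q (a t - e))
      (∑ n, m.linForm θ η q (a t - e) n * x n) s t := by
  have hw : HasDerivWithinAt (fun t => a t - e) x s t := h.sub_const e
  have hn := hasDerivWithinAt_pi.1 hw
  have hp : ∀ r, HasDerivWithinAt (fun t => m.pathSum (a t - e) r) (m.pathSum x r) s t := fun r =>
    HasDerivWithinAt.fun_sum fun i _ => hn (r, i)
  have ht : HasDerivWithinAt (fun t => m.total (a t - e)) (m.total x) s t :=
    HasDerivWithinAt.fun_sum fun n _ => hn n
  have hl : ∀ n, HasDerivWithinAt (fun t => m.linForm θ η q (a t - e) n) (m.linForm θ η q x n)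
      s t := fun n =>
    (((hn n).const_mul θ).add ((hp n.1).const_mul η)).sub (ht.const_mul q)
  have hsum : HasDerivWithinAt (fun t => ∑ n, m.linForm θ η q (a t - e) n * (a t - e) n)
      (∑ n, (m.linForm θ η q x n * (a t - e) n + m.linForm θ η q (a t - e) n * x n)) s t :=
    HasDerivWithinAt.fun_sum fun n _ => (hl n).mul (hn n)
  refine (hsum.div_const 2).congr_deriv ?_
  rw [Finset.sum_add_distrib, m.sum_linForm_mul_comm θ η q x]
  ring

lemma sq_norm_le_sum_sq {ι : Type*} [Fintype ι] (w : ι → ℝ) : ‖w‖ ^ 2 ≤ ∑ n, w n ^ 2 := by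
  have h0 : 0 ≤ ∑ n, w n ^ 2 := Finset.sum_nonneg fun n _ => sq_nonneg _
  rw [← Real.sq_sqrt h0]
  have : ‖w‖ ≤ √(∑ n, w n ^ 2) := by
    refine (pi_norm_le_iff_of_nonneg (Real.sqrt_nonneg _)).2 fun n => ?_
    refine Real.le_sqrt_of_sq_le ?_
    rw [Real.norm_eq_abs, sq_abs]
    exact Finset.single_le_sum (f := fun n => w n ^ 2) (fun n _ => sq_nonneg _) (Finset.mem_univ n)
  gcongr

/-- By Cauchy–Schwarz the squared total is at most `Q` times the sum of squared path sums. For `q ≥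
0` this loses at most `Q q`; for `q ≤ 0` the total only helps. -/
lemma quadForm_ge {θ η q β : ℝ} (h1 : β ≤ η) (h2 : β ≤ η - m.Q * q) (w : m.ISP → ℝ) :
    θ * ∑ n, w n ^ 2 + β * ∑ r, m.pathSum w r ^ 2 ≤ 2 * m.quadForm θ η q w := by
  have hcs : m.total w ^ 2 ≤ m.Q * ∑ r, m.pathSum w r ^ 2 := by
    have := sq_sum_le_card_mul_sum_sq (s := Finset.univ) (f := m.pathSum w)
    rwa [← total_eq_sum_pathSum, Finset.card_univ, Fintype.card_fin] at this
  have h0 : 0 ≤ ∑ r, m.pathSum w r ^ 2 := Finset.sum_nonneg fun n _ => sq_nonneg _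
  rw [quadForm_eq]
  rcases _root_.le_total q 0 with hq | hq
  · nlinarith [sq_nonneg (m.total w)]
  · nlinarith

/-- Componentwise properties of the projected step `y = max 0 (a + h)`. -/
lemma projected_step (a h e : ℝ) (ha : 0 ≤ a) (he : 0 ≤ e) :
    (max 0 (a + h) - a) ^ 2 ≤ h * (max 0 (a + h) - a) ∧
    -(h * (a - e)) ≤ |max 0 (a + h) - a| * (|h| + |a - e|) := by
  rcases _root_.le_total 0 (a + h) with hc | hc
  · rw [max_eq_right hc, add_sub_cancel_left]
    refine ⟨by rw [sq], ?_⟩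
    have h1 : -(h * (a - e)) ≤ |h| * |a - e| := by
      rw [← abs_mul]; exact neg_le_abs _
    nlinarith [abs_nonneg h]
  -- Truncated step: `h ≤ -a ≤ 0`. Since `e ≥ 0`, `a - e ≤ a`, which is the length of the step.
  · rw [max_eq_left hc, zero_sub]
    refine ⟨by nlinarith, ?_⟩
    rw [abs_neg, abs_of_nonneg ha, abs_of_nonpos (show h ≤ 0 by linarith)]
    rcases abs_cases (a - e) with ⟨h1, h2⟩ | ⟨h1, h2⟩ <;> rw [h1] <;> nlinarith

lemma exists_linForm_bound (θ η q : ℝ) :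
    ∃ C, 0 ≤ C ∧ ∀ w n, |m.linForm θ η q w n| ≤ C * ‖w‖ := by
  refine ⟨|θ| + |η| * m.I + |q| * Fintype.card m.ISP, by positivity, fun w n => ?_⟩
  have h0 : ∀ n, |w n| ≤ ‖w‖ := fun n => norm_le_pi_norm w n
  have h1 : |m.pathSum w n.1| ≤ m.I * ‖w‖ := by
    refine (Finset.abs_sum_le_sum_abs _ _).trans ?_
    refine (Finset.sum_le_card_nsmul _ _ _ fun i _ => h0 (n.1, i)).trans_eq ?_
    simp
  have h2 : |m.total w| ≤ Fintype.card m.ISP * ‖w‖ := by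
    refine (Finset.abs_sum_le_sum_abs _ _).trans ?_
    refine (Finset.sum_le_card_nsmul _ _ _ fun n _ => h0 n).trans_eq ?_
    simp
  have h3 : |m.linForm θ η q w n| ≤
      |θ| * |w n| + |η| * |m.pathSum w n.1| + |q| * |m.total w| := by
    rw [← abs_mul, ← abs_mul, ← abs_mul]
    exact (abs_sub _ _).trans (add_le_add_left (abs_add_le _ _) _)
  have h4 := mul_le_mul_of_nonneg_left (h0 n) (abs_nonneg θ)
  have h5 := mul_le_mul_of_nonneg_left h1 (abs_nonneg η)
  have h6 := mul_le_mul_of_nonneg_left h2 (abs_nonneg q)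
  linarith

/-- The two estimates behind `quadForm_decay`, for a single ISP. -/
lemma decay_estimates {a h e L X C c σ : ℝ} (ha : 0 ≤ a) (he : 0 ≤ e) (hw : |a - e| ≤ X)
    (hL : |L| ≤ C * X) (hh : |h + L| ≤ c * X) (hc1 : c ≤ 1) (hσ : 0 < σ) :
    L * (max 0 (a + h) - a) ≤ -((max 0 (a + h) - a) ^ 2 / 2) + c ^ 2 * X ^ 2 / 2 ∧
    L * (a - e) ≤ c * X ^ 2 + (max 0 (a + h) - a) ^ 2 / (2 * σ) + σ * (C + 2) ^ 2 * X ^ 2 / 2 := by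
  obtain ⟨h1, h2⟩ := projected_step a h e ha he
  set r := max 0 (a + h) - a
  have hX : 0 ≤ X := (abs_nonneg _).trans hw
  have hcX : c * X ≤ X := by nlinarith
  constructor
  · have h3 : (h + L) * r ≤ c * X * |r| := by
      refine (le_abs_self _).trans ?_
      rw [abs_mul]
      exact mul_le_mul_of_nonneg_right hh (abs_nonneg r)
    nlinarith [sq_nonneg (c * X - |r|), sq_abs r]
  · have h3 : (h + L) * (a - e) ≤ c * X * X := by
      refine (le_abs_self _).trans ?_
      rw [abs_mul]
      exact mul_le_mul hh hw (abs_nonneg _) ((abs_nonneg _).trans hh)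
    have h4 : |h| ≤ (C + 1) * X := by
      have := abs_sub (h + L) L
      rw [add_sub_cancel_right] at this
      linarith
    have h5 : |r| * (|h| + |a - e|) ≤ |r| * ((C + 2) * X) :=
      mul_le_mul_of_nonneg_left (by linarith) (abs_nonneg r)
    have h6 : |r| * ((C + 2) * X) ≤ r ^ 2 / (2 * σ) + σ * (C + 2) ^ 2 * X ^ 2 / 2 := by
      have h7 : r ^ 2 / (2 * σ) + σ * (C + 2) ^ 2 * X ^ 2 / 2 - |r| * ((C + 2) * X) =
          (|r| - σ * ((C + 2) * X)) ^ 2 / (2 * σ) := by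
        rw [← sq_abs r]; field_simp; ring
      have h8 : 0 ≤ (|r| - σ * ((C + 2) * X)) ^ 2 / (2 * σ) := by positivity
      linarith
    nlinarith

/-- If the drift is approximately `-linForm` near `e`, then the quadratic form decreases along the
dynamics, at every point at which it controls the norm. -/
lemma quadForm_decay {θ η q l : ℝ} (hl : 0 < l) {e : m.ISP → ℝ} (he : ∀ n, 0 ≤ e n)
    (hdrift : ∀ c > 0, ∃ ε > 0, ∀ a, ‖a - e‖ < ε → ∀ n,
      |m.drift a n + m.linForm θ η q (a - e) n| ≤ c * ‖a - e‖) :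
    ∃ s > 0, ∃ ε > 0, ∀ a, (∀ n, 0 ≤ a n) → ‖a - e‖ < ε →
      l * ‖a - e‖ ^ 2 ≤ m.quadForm θ η q (a - e) →
      ∑ n, m.linForm θ η q (a - e) n * m.field a n ≤ -(s * m.quadForm θ η q (a - e)) := by
  obtain ⟨C, hC, hCw⟩ := m.exists_linForm_bound θ η q
  set N : ℝ := (Fintype.card m.ISP : ℝ) with hN
  have hN0 : 0 < N := by
    have : 0 < m.Q * m.I := Nat.mul_pos m.Q_pos m.I_pos
    rw [hN, Fintype.card_prod, Fintype.card_fin, Fintype.card_fin]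
    exact_mod_cast this
  -- Weight in Young's inequality, chosen so that the `N` error terms `σ (C + 2) ^ 2 X ^ 2 / 2` add
  -- up to `l X ^ 2 / 2 ≤ V / 2`.
  set σ := l / (N * (C + 2) ^ 2) with hσ
  have hσ0 : 0 < σ := by positivity
  -- Tolerance for the linearization error. With `R` the sum of squared steps, the second bound
  -- gives `V ≤ R / (2 σ)`; the third bounds the error in the derivative by `σ V / 2`. Since `-R / 2
  -- ≤ -σ V`, the rate `σ / 2` remains.
  set c := min 1 (min (l / (2 * N)) (σ * l / N)) with hc
  have hc0 : 0 < c := by positivity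
  have hc1 : c ≤ 1 := min_le_left _ _
  have hc2 : N * c ≤ l / 2 := by
    have : c ≤ l / (2 * N) := (min_le_right _ _).trans (min_le_left _ _)
    rw [le_div_iff₀ (by positivity)] at this
    linarith
  have hc3 : N * c ^ 2 ≤ σ * l := by
    have : c ≤ σ * l / N := (min_le_right _ _).trans (min_le_right _ _)
    rw [le_div_iff₀ hN0] at this
    have h2 : c ^ 2 ≤ c := by nlinarith
    nlinarith
  have hσN : N * (σ * (C + 2) ^ 2) = l := by
    rw [hσ]; field_simp
  obtain ⟨ε, hε, hd⟩ := hdrift c hc0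
  refine ⟨σ / 2, half_pos hσ0, ε, hε, fun a ha hae hV => ?_⟩
  set X := ‖a - e‖
  have est := fun n => decay_estimates (ha n) (he n) (norm_le_pi_norm (a - e) n) (hCw (a - e) n)
    (hd a hae n) hc1 hσ0
  have e1 := Finset.sum_le_sum fun n (_ : n ∈ Finset.univ) => (est n).1
  have e2 := Finset.sum_le_sum fun n (_ : n ∈ Finset.univ) => (est n).2
  rw [Finset.sum_add_distrib, Finset.sum_neg_distrib, ← Finset.sum_div, Finset.sum_const,
    Finset.card_univ, nsmul_eq_mul, ← hN] at e1
  rw [Finset.sum_add_distrib, Finset.sum_add_distrib, ← Finset.sum_div, Finset.sum_const,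
    Finset.sum_const, Finset.card_univ, nsmul_eq_mul, nsmul_eq_mul, ← hN] at e2
  have e3 : ∑ n, m.linForm θ η q (a - e) n * (a n - e n) = 2 * m.quadForm θ η q (a - e) := by
    rw [quadForm, mul_div_cancel₀ _ two_ne_zero]; rfl
  rw [e3] at e2
  set V := m.quadForm θ η q (a - e)
  have hfield : ∀ n, m.field a n = max 0 (a n + m.drift a n) - a n := fun n => rfl
  simp only [hfield]
  set R := ∑ n, (max 0 (a n + m.drift a n) - a n) ^ 2
  have hX : 0 ≤ X ^ 2 := sq_nonneg _
  have e4 : V ≤ R / (2 * σ) := by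
    have := mul_le_mul_of_nonneg_right hc2 hX
    have : N * (σ * (C + 2) ^ 2 * X ^ 2 / 2) = l * X ^ 2 / 2 := by rw [← hσN]; ring
    linarith
  rw [le_div_iff₀ (by positivity)] at e4
  have e5 : N * (c ^ 2 * X ^ 2 / 2) ≤ σ * V / 2 := by
    have h1 := mul_le_mul_of_nonneg_right hc3 hX
    have h2 := mul_le_mul_of_nonneg_left hV hσ0.le
    linarith
  linarith

/-! ### The equilibrium quadratic on constant profiles -/

lemma pathSum_const (x : ℝ) (r : Fin m.Q) : m.pathSum (fun _ => x) r = m.I * x := by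
  simp [pathSum]

lemma total_const (x : ℝ) : m.total (fun _ => x) = m.Q * m.I * x := by
  rw [total_eq_sum_pathSum]; simp [pathSum_const, mul_assoc]

lemma denom_sq_sub_radicand_const (x : ℝ) (n : m.ISP) :
    m.denom (fun _ => x) ^ 2 - m.radicand (fun _ => x) n = m.T₁ * x ^ 2 + m.T₂ * x + m.T₃ := by
  simp only [radicand, denom, rest, margin, total_const, pathSum_const, T₁, T₂, T₃, ratio]
  ring

lemma ratio_mul_φ₁_le_one : m.ratio * m.φ₁ ≤ 1 := by
  rw [ratio, div_mul_eq_mul_div, div_le_one m.cost_pos]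
  linarith [m.γ₁_nonneg]

lemma ratio_mul_φ₁_nonneg : 0 ≤ m.ratio * m.φ₁ := mul_nonneg m.ratio_nonneg m.φ₁_nonneg

lemma one_le_Q_mul_I : 1 ≤ (m.Q : ℝ) * m.I := by
  have := m.one_le_Q
  have := m.one_le_I
  nlinarith

lemma T₁_pos : 0 < m.T₁ := by
  have hQ := m.one_le_Q
  have hI := m.one_le_I
  have hQI := m.one_le_Q_mul_I
  have h : m.T₁ = m.α₁ ^ 2 * m.I *
      ((m.Q : ℝ) ^ 2 * m.I - m.ratio * m.φ₁ * (((m.Q : ℝ) * m.I - 1) * ((m.Q : ℝ) - 1))) := by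
    rw [T₁, ratio]; ring
  rw [h]
  refine mul_pos (mul_pos (pow_pos m.α₁_pos 2) (by linarith)) ?_
  have h1 : m.ratio * m.φ₁ * (((m.Q : ℝ) * m.I - 1) * ((m.Q : ℝ) - 1)) ≤
      1 * (((m.Q : ℝ) * m.I - 1) * ((m.Q : ℝ) - 1)) :=
    mul_le_mul_of_nonneg_right m.ratio_mul_φ₁_le_one
      (mul_nonneg (by linarith) (by linarith))
  nlinarith

/-- After multiplication by `u`, the hypothesis `ratio * u * M ≤ P ^ 2` eliminates the margin `M`.
The rest follows from `ratio * φ₁ ≤ 1`, `u ≤ P` and `(Q - 1) P ≤ Q u`. -/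
lemma T₂_pos (h : 0 ≤ m.T₃) : 0 < m.T₂ := by
  have hQ := m.one_le_Q
  have hI := m.one_le_I
  have hQI := m.one_le_Q_mul_I
  have hα₀ := m.α₀_nonneg
  set u := 1 + ((m.Q : ℝ) - 1) * m.α₀ with hu
  set P := 1 + (m.Q : ℝ) * m.α₀ with hP
  have hu1 : 1 ≤ u := by
    have := mul_nonneg (sub_nonneg.2 hQ) hα₀
    linarith
  have huP : u ≤ P := by rw [hu, hP]; linarith
  set M := m.φ₁ * P + m.α₁ * (m.ρ - m.φ₀) with hM
  have hT₃ : m.ratio * u * M ≤ P ^ 2 := by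
    have : m.T₃ = P ^ 2 - m.ratio * u * M := by rw [T₃, ratio]
    linarith
  have hT₂ : m.T₂ = m.α₁ * (2 * (m.Q * m.I) * P - m.ratio * m.φ₁ * ((m.Q * m.I - 1) * u)
      - m.I * ((m.Q : ℝ) - 1) * (m.ratio * M)) := by
    rw [T₂, ratio]; ring
  rw [hT₂]
  refine mul_pos m.α₁_pos (pos_of_mul_pos_left ?_ (by linarith : 0 ≤ u))
  have h1 : m.ratio * m.φ₁ * ((m.Q * m.I - 1) * u) ≤ 1 * ((m.Q * m.I - 1) * u) :=
    mul_le_mul_of_nonneg_right m.ratio_mul_φ₁_le_one (mul_nonneg (by linarith) (by linarith))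
  have h2 : m.I * ((m.Q : ℝ) - 1) * (m.ratio * u * M) ≤ m.I * ((m.Q : ℝ) - 1) * P ^ 2 :=
    mul_le_mul_of_nonneg_left hT₃ (mul_nonneg (by linarith) (by linarith))
  have h3 : ((m.Q : ℝ) - 1) * P ≤ m.Q * u := by
    rw [hu, hP]; nlinarith
  have h4 : m.I * ((m.Q : ℝ) - 1) * P ^ 2 ≤ m.Q * m.I * P * u := by
    have := mul_le_mul_of_nonneg_left h3 (show 0 ≤ m.I * P by nlinarith)
    nlinarith
  have h5 : (m.Q * m.I - 1) * u * u < m.Q * m.I * P * u := by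
    have h6 : (m.Q * m.I - 1) * u < m.Q * m.I * P := by nlinarith
    exact mul_lt_mul_of_pos_right h6 (by linarith)
  nlinarith

lemma equilibriumSum_nonneg : 0 ≤ m.equilibriumSum := le_max_left _ _

lemma equilibriumSum_of_nonneg (h : 0 ≤ m.T₃) : m.equilibriumSum = 0 := by
  refine max_eq_left (div_nonpos_of_nonpos_of_nonneg ?_ (by linarith [m.T₁_pos]))
  rw [sub_nonpos]
  -- This also covers a negative discriminant, whose `Real.sqrt` is zero.
  refine Real.sqrt_le_iff.2 ⟨(m.T₂_pos h).le, ?_⟩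
  have := mul_nonneg m.T₁_pos.le h
  linarith

lemma equilibriumSum_root (h : m.T₃ ≤ 0) :
    m.T₁ * m.equilibriumSum ^ 2 + m.T₂ * m.equilibriumSum + m.T₃ = 0 := by
  rcases h.eq_or_lt with h0 | h0
  · rw [m.equilibriumSum_of_nonneg h0.ge, h0]; ring
  · have hT := m.T₁_pos
    have h1 : m.T₂ ^ 2 ≤ m.T₂ ^ 2 - 4 * m.T₁ * m.T₃ := by nlinarith
    have h2 : 0 ≤ m.unrestrictedSum :=
      div_nonneg (sub_nonneg.2 (Real.le_sqrt_of_sq_le h1)) (by linarith)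
    rw [equilibriumSum, max_eq_right h2, unrestrictedSum]
    have h3 := Real.sq_sqrt ((sq_nonneg _).trans h1)
    generalize √(m.T₂ ^ 2 - 4 * m.T₁ * m.T₃) = z at h3
    field_simp
    linear_combination h3

/-! ### Derivative of the drift -/

section Linearization

variable {m}

/-- The total as a continuous linear map. -/
def totalCLM (m : HomogeneousMarket) : (m.ISP → ℝ) →L[ℝ] ℝ :=
  ∑ n, ContinuousLinearMap.proj (R := ℝ) (φ := fun _ : m.ISP => ℝ) n

/-- The path sum as a continuous linear map. -/
def pathSumCLM (m : HomogeneousMarket) (r : Fin m.Q) : (m.ISP → ℝ) →L[ℝ] ℝ :=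
  ∑ i, ContinuousLinearMap.proj (R := ℝ) (φ := fun _ : m.ISP => ℝ) (r, i)

lemma totalCLM_apply (a : m.ISP → ℝ) : m.totalCLM a = m.total a := by
  simp [totalCLM, total]

lemma pathSumCLM_apply (r : Fin m.Q) (a : m.ISP → ℝ) : m.pathSumCLM r a = m.pathSum a r := by
  simp [pathSumCLM, pathSum]

lemma hasFDerivAt_total (e : m.ISP → ℝ) : HasFDerivAt m.total m.totalCLM e := by
  have h : m.total = m.totalCLM := by ext a; rw [totalCLM_apply]
  rw [h]; exact m.totalCLM.hasFDerivAt

lemma hasFDerivAt_pathSum (r : Fin m.Q) (e : m.ISP → ℝ) :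
    HasFDerivAt (fun a => m.pathSum a r) (m.pathSumCLM r) e := by
  have h : (fun a => m.pathSum a r) = m.pathSumCLM r := by ext a; rw [pathSumCLM_apply]
  rw [h]; exact (m.pathSumCLM r).hasFDerivAt

lemma contDiff_radicand (n : m.ISP) : ContDiff ℝ 1 fun a => m.radicand a n := by
  unfold radicand rest margin total pathSum
  fun_prop

lemma contDiff_denom : ContDiff ℝ 1 m.denom := by
  unfold denom total
  fun_prop

lemma hasFDerivAt_drift (e : m.ISP → ℝ) (n : m.ISP) (h0 : m.radicand e n ≠ 0) :
    ∃ L : (m.ISP → ℝ) →L[ℝ] ℝ, HasFDerivAt (fun a => m.drift a n) L e ∧ ∀ w,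
      L w = m.ratio * (m.margin e n * (m.total w - m.pathSum w n.1)
        + m.rest e n.1 * m.φ₁ * (m.total w - w n)) / (2 * √(m.radicand e n)) - m.total w := by
  have ht := hasFDerivAt_total e
  have hp := hasFDerivAt_pathSum n.1 e
  have hn : HasFDerivAt (fun a : m.ISP → ℝ => a n)
    (ContinuousLinearMap.proj (R := ℝ) (φ := fun _ : m.ISP => ℝ) n) e := hasFDerivAt_apply n e
  have hrest := ((ht.sub hp).const_mul m.α₁).const_add (1 + ((m.Q : ℝ) - 1) * m.α₀)
  have hmargin := ((((ht.sub hn).const_mul m.α₁).const_add (1 + m.Q * m.α₀)).const_mul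
    m.φ₁).add_const (m.α₁ * (m.ρ - m.φ₀))
  have hden := (ht.const_mul m.α₁).const_add (1 + m.Q * m.α₀)
  have hrad := (hrest.const_mul m.ratio).mul hmargin
  have hdrift := ((hrad.sqrt h0).sub hden).mul_const m.α₁⁻¹
  refine ⟨_, hdrift, fun w => ?_⟩
  have hα := m.α₁_pos.ne'
  simp only [_root_.smul_apply, _root_.sub_apply,
    _root_.add_apply, totalCLM_apply, pathSumCLM_apply, ContinuousLinearMap.proj_apply,
    smul_eq_mul]
  change m.α₁⁻¹ * (1 / (2 * √(m.radicand e n)) * (m.ratio * m.rest e n.1 * _ +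
    m.margin e n * _) - _) = _
  field_simp
  ring

end Linearization

/-! ### Rest point and asymptotic stability -/

lemma equilibriumProfile_nonneg (n : m.ISP) : 0 ≤ m.equilibriumProfile n := m.equilibriumSum_nonneg

lemma denom_pos {a : m.ISP → ℝ} (ha : ∀ n, 0 ≤ a n) (n : m.ISP) : 0 < m.denom a := by
  have := m.one_le_denom_sub ha n
  have := mul_nonneg m.α₁_pos.le (ha n)
  linarith

lemma radicand_equilibriumProfile (h : m.T₃ ≤ 0) (n : m.ISP) :
    m.radicand m.equilibriumProfile n = m.denom m.equilibriumProfile ^ 2 := by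
  have h1 := m.denom_sq_sub_radicand_const m.equilibriumSum n
  rw [m.equilibriumSum_root h, sub_eq_zero] at h1
  exact h1.symm

lemma drift_equilibriumProfile (h : m.T₃ ≤ 0) (n : m.ISP) :
    m.drift m.equilibriumProfile n = 0 := by
  rw [drift, m.radicand_equilibriumProfile h,
    Real.sqrt_sq (m.denom_pos m.equilibriumProfile_nonneg n).le, sub_self, zero_div]

lemma equilibriumProfile_eq_zero (h : 0 ≤ m.T₃) : m.equilibriumProfile = 0 := by
  ext n; exact m.equilibriumSum_of_nonneg h

lemma drift_zero_neg (h : 0 < m.T₃) (n : m.ISP) : m.drift 0 n < 0 := by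
  have h1 := m.denom_sq_sub_radicand_const 0 n
  have h2 : (fun _ => 0 : m.ISP → ℝ) = 0 := rfl
  rw [h2] at h1
  refine div_neg_of_neg_of_pos (sub_neg.2 ?_) m.α₁_pos
  rw [Real.sqrt_lt' (m.denom_pos (a := 0) (fun _ => le_rfl) n)]
  linarith

lemma bestResponse_equilibriumProfile (n : m.ISP) :
    m.bestResponse m.equilibriumProfile n = m.equilibriumProfile n := by
  rcases le_or_gt m.T₃ 0 with h | h
  · rw [bestResponse, m.drift_equilibriumProfile h, add_zero,
      max_eq_right (m.equilibriumProfile_nonneg n)]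
  · rw [m.equilibriumProfile_eq_zero h.le, bestResponse]
    exact max_eq_left (by simpa using (m.drift_zero_neg h n).le)

lemma continuous_drift (n : m.ISP) : Continuous fun a => m.drift a n := by
  unfold drift
  have h1 := (m.contDiff_radicand n).continuous
  have h2 := (contDiff_denom (m := m)).continuous
  fun_prop

lemma bestResponse_eventually_eq_zero (h : 0 < m.T₃) : ∀ᶠ a in 𝓝 0, m.bestResponse a = 0 := by
  have h1 : ∀ n, ∀ᶠ a in 𝓝 (0 : m.ISP → ℝ), a n + m.drift a n < 0 := fun n => by
    have hc : Continuous fun a : m.ISP → ℝ => a n + m.drift a n :=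
      (continuous_apply n).add (m.continuous_drift n)
    refine hc.continuousAt.eventually_lt continuousAt_const ?_
    simpa using m.drift_zero_neg h n
  filter_upwards [eventually_all.2 h1] with a ha
  ext n
  exact max_eq_left (ha n).le

lemma isAsymptoticallyStable_of_T₃_pos (h : 0 < m.T₃) :
    m.IsAsymptoticallyStable m.equilibriumProfile := by
  rw [m.equilibriumProfile_eq_zero h.le]
  have hb := m.bestResponse_eventually_eq_zero h
  obtain ⟨ε, hε, hball⟩ := Metric.eventually_nhds_iff.1 hb
  have hV : m.IsLyapunovFunction 0 (fun a => m.quadForm 1 0 0 (a - 0))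
      (fun a x => ∑ n, m.linForm 1 0 0 (a - 0) n * x n)
      (fun a => -(2 * m.quadForm 1 0 0 (a - 0))) (1 / 2) ε := by
    have hq : ∀ a : m.ISP → ℝ, 2 * m.quadForm 1 0 0 (a - 0) = ∑ n, a n ^ 2 := fun a => by
      rw [quadForm_eq]; simp
    refine ⟨by norm_num, hε, ?_, ?_, m.hasDerivWithinAt_quadForm 1 0 0 0, ?_, ?_, ?_⟩
    · exact (m.continuous_quadForm 1 0 0).comp (continuous_id.sub continuous_const)
    · have := hq 0
      simp at this
      simpa using this
    · intro a _ _
      have h1 := hq a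
      have h2 := sq_norm_le_sum_sq a
      rw [sub_zero] at *
      linarith
    · intro a _ ha
      rw [← dist_eq_norm] at ha
      have h1 : m.field a = -a := by
        ext n; simp [field, hball ha]
      rw [hq, h1, ← Finset.sum_neg_distrib]
      refine Finset.sum_le_sum fun n _ => ?_
      simp [linForm, sq]
    · intro a _ _
      rw [hq]
      exact neg_nonpos.2 (Finset.sum_nonneg fun n _ => sq_nonneg _)
  refine hV.isAsymptoticallyStable two_pos ⟨0, _, hb, fun x hx y hy => ?_⟩
  have hx : m.bestResponse x = 0 := hx
  have hy : m.bestResponse y = 0 := hy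
  simp [hx, hy]

/-- Away from zero radicands the square root is smooth, and truncation at zero is 1-Lipschitz. -/
lemma exists_lipschitzOnWith_bestResponse {e : m.ISP → ℝ} (h : ∀ n, m.radicand e n ≠ 0) :
    ∃ K, ∃ s ∈ 𝓝 e, LipschitzOnWith K m.bestResponse s := by
  have hg : ContDiffAt ℝ 1 (fun a n => a n + m.drift a n) e := by
    refine contDiffAt_pi.2 fun n => ?_
    have h1 := ((m.contDiff_radicand n).contDiffAt (x := e)).sqrt (h n)
    have h2 := (contDiff_denom (m := m)).contDiffAt (x := e)
    exact (contDiff_apply ℝ ℝ n).contDiffAt.add ((h1.sub h2).div_const _)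
  obtain ⟨K, s, hs, hK⟩ := hg.exists_lipschitzOnWith
  refine ⟨K, s, hs, LipschitzOnWith.of_dist_le_mul fun x hx y hy => ?_⟩
  refine le_trans ?_ (hK.dist_le_mul x hx y hy)
  rw [dist_pi_le_iff dist_nonneg]
  intro n
  have h1 := (((LipschitzWith.id (α := ℝ)).const_max 0).dist_le_mul
    (x n + m.drift x n) (y n + m.drift y n))
  rw [NNReal.coe_one, one_mul] at h1
  exact h1.trans (dist_le_pi_dist (fun n => x n + m.drift x n) (fun n => y n + m.drift y n) n)

/-- The linearization of the drift at the equilibrium, and the definiteness of its form. -/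
lemma exists_linearization (h : m.T₃ ≤ 0) :
    ∃ θ η q β : ℝ, 0 < β ∧ β ≤ η ∧ β ≤ η - m.Q * q ∧ 0 ≤ θ ∧ (0 < m.φ₁ → 0 < θ) ∧
      (m.φ₁ = 0 → θ = 0) ∧
      ∀ c > 0, ∃ ε > 0, ∀ a, ‖a - m.equilibriumProfile‖ < ε → ∀ n,
        |m.drift a n + m.linForm θ η q (a - m.equilibriumProfile) n| ≤
          c * ‖a - m.equilibriumProfile‖ := by
  have hQ := m.one_le_Q
  have hI := m.one_le_I
  have hA := m.equilibriumSum_nonneg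
  set e := m.equilibriumProfile with he
  have he0 : ∀ n, 0 ≤ e n := m.equilibriumProfile_nonneg
  have hec : e = fun _ => m.equilibriumSum := rfl
  set D := m.denom e with hD
  set u := 1 + ((m.Q : ℝ) - 1) * (m.α₀ + m.α₁ * m.I * m.equilibriumSum) with hu
  set v := m.α₀ + m.α₁ * m.I * m.equilibriumSum with hv
  have hv0 : 0 ≤ v := by
    have := mul_nonneg (mul_nonneg m.α₁_pos.le (zero_le_one.trans hI)) hA
    linarith [m.α₀_nonneg]
  have hrest : ∀ r, m.rest e r = u := fun r => by
    rw [rest, hec, total_const, pathSum_const, hu]; ring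
  have hDv : D = 1 + m.Q * v := by
    rw [hD, denom, hec, total_const, hv]; ring
  have hD1 : 1 ≤ D := by nlinarith
  have hu1 : 1 ≤ u := by nlinarith
  have huD : u ≤ D := by rw [hDv, hu]; linarith
  have hD0 : 0 < D := by linarith
  have hu0 : 0 < u := by linarith
  have hrad : ∀ n, m.radicand e n = D ^ 2 := m.radicand_equilibriumProfile h
  have hM : ∀ n, m.ratio * m.margin e n = D ^ 2 / u := fun n => by
    have := hrad n
    rw [radicand, hrest] at this
    rw [eq_div_iff hu0.ne']
    linarith
  have hc : 0 < m.ratio := by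
    refine m.ratio_nonneg.lt_of_ne' fun h0 => ?_
    have h1 := hM (⟨0, m.Q_pos⟩, ⟨0, m.I_pos⟩)
    rw [h0, zero_mul] at h1
    have : 0 < D ^ 2 / u := by positivity
    linarith
  set θ := m.ratio * m.φ₁ * u / (2 * D) with hθ
  set η := D / (2 * u) with hη
  have hη0 : 0 < η := by positivity
  have hθ1 : θ ≤ 1 / 2 := by
    rw [hθ, div_le_div_iff₀ (by positivity) two_pos]
    have := mul_le_mul m.ratio_mul_φ₁_le_one huD hu0.le zero_le_one
    linarith
  have hη1 : (m.Q - 1) * η < m.Q / 2 := by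
    rw [hη, ← mul_div_assoc, div_lt_div_iff₀ (by positivity) two_pos, hDv, hu]
    nlinarith
  -- The derivative of the drift is `η (W - W_r) + θ (W - w_n) - W`, whence `q = θ + η - 1`.
  -- Positivity of `Q (1 - θ) - (Q - 1) η` follows from `θ ≤ 1 / 2` and `(Q - 1) η < Q / 2`.
  refine ⟨θ, η, θ + η - 1, min η (η - m.Q * (θ + η - 1)), lt_min hη0 ?_, min_le_left _ _,
    min_le_right _ _, ?_, ?_, ?_, ?_⟩
  · nlinarith
  · have := m.ratio_mul_φ₁_nonneg
    positivity
  · intro hφ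
    positivity
  · intro hφ
    rw [hθ, hφ]; simp
  · intro c hc0
    have hn : ∀ n, ∀ᶠ a in 𝓝 e,
        |m.drift a n + m.linForm θ η (θ + η - 1) (a - e) n| ≤ c * ‖a - e‖ := fun n => by
      obtain ⟨L, hL, hLw⟩ := hasFDerivAt_drift e n (by rw [hrad]; positivity)
      filter_upwards [hL.isLittleO.def hc0] with a ha
      rw [Real.norm_eq_abs, m.drift_equilibriumProfile h, sub_zero] at ha
      convert ha using 2
      rw [hLw, hrad, Real.sqrt_sq hD0.le, hrest, linForm, sub_eq_add_neg]
      congr 1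
      have h1 : m.ratio * (m.margin e n * (m.total (a - e) - m.pathSum (a - e) n.1)
          + u * m.φ₁ * (m.total (a - e) - (a - e) n)) =
          D ^ 2 / u * (m.total (a - e) - m.pathSum (a - e) n.1) +
          m.ratio * m.φ₁ * u * (m.total (a - e) - (a - e) n) := by
        rw [← hM n]; ring
      rw [h1, hθ, hη]
      field_simp
      ring
    obtain ⟨ε, hε, hball⟩ := Metric.eventually_nhds_iff.1 (eventually_all.2 hn)
    exact ⟨ε, hε, fun a ha => hball (by rwa [dist_eq_norm])⟩

lemma radicand_equilibriumProfile_ne_zero (h : m.T₃ ≤ 0) (n : m.ISP) :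
    m.radicand m.equilibriumProfile n ≠ 0 := by
  rw [m.radicand_equilibriumProfile h]
  exact (pow_pos (m.denom_pos m.equilibriumProfile_nonneg n) 2).ne'

lemma isAsymptoticallyStable_of_T₃_nonpos (h : m.T₃ ≤ 0)
    (hcase : 0 < m.φ₁ ∨ m.I = 1 ∨ m.equilibriumSum = 0) :
    m.IsAsymptoticallyStable m.equilibriumProfile := by
  obtain ⟨θ, η, q, β, hβ, h1, h2, hθ, hθ1, -, hlin⟩ := m.exists_linearization h
  set e := m.equilibriumProfile with he
  have key : ∃ l > 0, ∀ a : m.ISP → ℝ, (∀ n, 0 ≤ a n) →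
      l * ‖a - e‖ ^ 2 ≤ m.quadForm θ η q (a - e) := by
    have hge := fun a => m.quadForm_ge (θ := θ) h1 h2 (a - e)
    have hn1 := fun a => sq_norm_le_sum_sq (a - e)
    by_cases hφ : 0 < m.φ₁
    · refine ⟨θ / 2, half_pos (hθ1 hφ), fun a _ => ?_⟩
      have := hge a
      have := mul_le_mul_of_nonneg_left (hn1 a) hθ
      have : 0 ≤ β * ∑ r, m.pathSum (a - e) r ^ 2 :=
        mul_nonneg hβ.le (Finset.sum_nonneg fun r _ => sq_nonneg _)
      linarith
    · refine ⟨β / 2, half_pos hβ, fun a ha => ?_⟩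
      have h3 : ‖a - e‖ ≤ √(∑ r, m.pathSum (a - e) r ^ 2) := by
        refine (pi_norm_le_iff_of_nonneg (Real.sqrt_nonneg _)).2 fun n => ?_
        refine Real.le_sqrt_of_sq_le (le_trans ?_ (Finset.single_le_sum
          (f := fun r => m.pathSum (a - e) r ^ 2) (fun r _ => sq_nonneg _) (Finset.mem_univ n.1)))
        rw [Real.norm_eq_abs, sq_abs]
        rcases hcase.resolve_left hφ with hI | h0
        · have : m.pathSum (a - e) n.1 = (a - e) n := by
            have : Subsingleton (Fin m.I) := by rw [hI]; infer_instance
            exact Fintype.sum_subsingleton (fun i => (a - e) (n.1, i)) n.2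
          rw [this]
        · have : a - e = a := by ext n; simp [he, equilibriumProfile, h0]
          rw [this]
          exact pow_le_pow_left₀ (ha n) (m.le_pathSum ha n) 2
      have h0 : 0 ≤ ∑ r, m.pathSum (a - e) r ^ 2 := Finset.sum_nonneg fun r _ => sq_nonneg _
      have h4 := pow_le_pow_left₀ (norm_nonneg _) h3 2
      rw [Real.sq_sqrt h0] at h4
      have := hge a
      have := mul_le_mul_of_nonneg_left h4 hβ.le
      have : 0 ≤ θ * ∑ n, (a - e) n ^ 2 :=
        mul_nonneg hθ (Finset.sum_nonneg fun r _ => sq_nonneg _)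
      linarith
  obtain ⟨l, hl, hle⟩ := key
  obtain ⟨s, hs, ε, hε, hdec⟩ := m.quadForm_decay hl m.equilibriumProfile_nonneg hlin
  refine IsLyapunovFunction.isAsymptoticallyStable (V := fun a => m.quadForm θ η q (a - e))
    (V' := fun a x => ∑ n, m.linForm θ η q (a - e) n * x n) (l := l) (ε := ε) hs
    ⟨hl, hε, ?_, ?_, m.hasDerivWithinAt_quadForm θ η q e, fun a ha _ => hle a ha, ?_, ?_⟩
    (m.exists_lipschitzOnWith_bestResponse (m.radicand_equilibriumProfile_ne_zero h))
  · exact (m.continuous_quadForm θ η q).comp (continuous_id.sub continuous_const)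
  · simp [quadForm]
  · exact fun a ha hae => hdec a ha hae (hle a ha)
  · intro a ha _
    have := hle a ha
    have h0 : 0 ≤ m.quadForm θ η q (a - e) := le_trans (by positivity) this
    exact neg_nonpos.2 (mul_nonneg hs.le h0)

/-! ### The degenerate case: `φ₁ = 0` with an interior equilibrium -/

/-- Averaging over each path. -/
def pathAverage (a : m.ISP → ℝ) : m.ISP → ℝ := fun n => m.pathSum a n.1 / m.I

lemma I_pos' : (0 : ℝ) < m.I := by exact_mod_cast m.I_pos

lemma pathSum_of_const_on_path (f : Fin m.Q → ℝ) (r : Fin m.Q) :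
    m.pathSum (fun n => f n.1) r = m.I * f r := by
  simp [pathSum]

lemma pathSum_pathAverage (a : m.ISP → ℝ) (r : Fin m.Q) :
    m.pathSum (m.pathAverage a) r = m.pathSum a r := by
  refine (m.pathSum_of_const_on_path (fun r => m.pathSum a r / m.I) r).trans ?_
  have := m.I_pos'
  field_simp

/-- For `φ₁ = 0` the margin is constant, so an ISP's own sum enters only through its path sum. -/
lemma drift_eq_of_pathSum_eq (hφ : m.φ₁ = 0) {a b : m.ISP → ℝ}
    (h : ∀ r, m.pathSum a r = m.pathSum b r) {n n' : m.ISP} (hn : n.1 = n'.1) :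
    m.drift a n = m.drift b n' := by
  have ht : m.total a = m.total b := by
    rw [total_eq_sum_pathSum, total_eq_sum_pathSum]
    exact Finset.sum_congr rfl fun r _ => h r
  simp only [drift, radicand, rest, margin, denom, ht, h, hφ, zero_mul, hn]

lemma linForm_eq_of_pathSum_eq (η q : ℝ) {a b : m.ISP → ℝ}
    (h : ∀ r, m.pathSum a r = m.pathSum b r) (n : m.ISP) :
    m.linForm 0 η q a n = m.linForm 0 η q b n := by
  have ht : m.total a = m.total b := by
    rw [total_eq_sum_pathSum, total_eq_sum_pathSum]
    exact Finset.sum_congr rfl fun r _ => h r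
  simp only [linForm, ht, h, zero_mul]

lemma quadForm_eq_of_pathSum_eq (η q : ℝ) {a b : m.ISP → ℝ}
    (h : ∀ r, m.pathSum a r = m.pathSum b r) : m.quadForm 0 η q a = m.quadForm 0 η q b := by
  have ht : m.total a = m.total b := by
    rw [total_eq_sum_pathSum, total_eq_sum_pathSum]
    exact Finset.sum_congr rfl fun r _ => h r
  have h1 := m.quadForm_eq 0 η q a
  have h2 := m.quadForm_eq 0 η q b
  simp only [ht, h] at h1
  linarith

lemma norm_pathAverage_le (a : m.ISP → ℝ) : ‖m.pathAverage a‖ ≤ ‖a‖ := by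
  refine (pi_norm_le_iff_of_nonneg (norm_nonneg _)).2 fun n => ?_
  rw [pathAverage, Real.norm_eq_abs, abs_div, abs_of_pos m.I_pos', div_le_iff₀ m.I_pos']
  refine (Finset.abs_sum_le_sum_abs _ _).trans ?_
  refine (Finset.sum_le_card_nsmul _ _ ‖a‖ fun i _ => norm_le_pi_norm a (n.1, i)).trans_eq ?_
  simp [mul_comm]

lemma sum_sq_pathSum_le (w : m.ISP → ℝ) : ∑ r, m.pathSum w r ^ 2 ≤ m.I * ∑ n, w n ^ 2 := by
  rw [Fintype.sum_prod_type, Finset.mul_sum]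
  refine Finset.sum_le_sum fun r _ => ?_
  have := sq_sum_le_card_mul_sum_sq (s := Finset.univ) (f := fun i => w (r, i))
  rwa [Finset.card_univ, Fintype.card_fin] at this

lemma sq_norm_pathAverage_le (w : m.ISP → ℝ) :
    ‖m.pathAverage w‖ ^ 2 ≤ ∑ r, m.pathSum w r ^ 2 := by
  have h0 : 0 ≤ ∑ r, m.pathSum w r ^ 2 := Finset.sum_nonneg fun r _ => sq_nonneg _
  have h1 : ‖m.pathAverage w‖ ≤ √(∑ r, m.pathSum w r ^ 2) := by
    refine (pi_norm_le_iff_of_nonneg (Real.sqrt_nonneg _)).2 fun n => ?_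
    refine Real.le_sqrt_of_sq_le (le_trans ?_ (Finset.single_le_sum
      (f := fun r => m.pathSum w r ^ 2) (fun r _ => sq_nonneg _) (Finset.mem_univ n.1)))
    rw [Real.norm_eq_abs, sq_abs, pathAverage, div_pow]
    exact div_le_self (sq_nonneg _) (one_le_pow₀ m.one_le_I)
  exact (pow_le_pow_left₀ (norm_nonneg _) h1 2).trans_eq (Real.sq_sqrt h0)

/-- The quadratic form that in addition measures differences within the paths. -/
lemma quadForm_add_spread (η q : ℝ) (w : m.ISP → ℝ) :
    2 * m.quadForm 2 (η - 2 / m.I) q w =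
      2 * m.quadForm 0 η q w + 2 * (∑ n, w n ^ 2 - (∑ r, m.pathSum w r ^ 2) / m.I) := by
  rw [quadForm_eq, quadForm_eq]; ring

/-- Deviations from path averages are orthogonal to vectors constant on paths, such as the drift for
`φ₁ = 0`. The spread thus does not change along the flow. -/
lemma sum_linForm_add_spread (η q : ℝ) (w x : m.ISP → ℝ)
    (hx : ∀ n n' : m.ISP, n.1 = n'.1 → x n = x n') :
    ∑ n, m.linForm 2 (η - 2 / m.I) q w n * x n = ∑ n, m.linForm 0 η q w n * x n := by
  have h1 : ∀ n, m.linForm 2 (η - 2 / m.I) q w n * x n =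
      m.linForm 0 η q w n * x n + 2 * (w n * x n - m.pathSum w n.1 / m.I * x n) := fun n => by
    rw [linForm, linForm]; ring
  have h2 : ∑ n : m.ISP, (w n * x n - m.pathSum w n.1 / m.I * x n) = 0 := by
    rw [Fintype.sum_prod_type]
    refine Finset.sum_eq_zero fun r _ => ?_
    have h3 : ∀ i, x (r, i) = x (r, ⟨0, m.I_pos⟩) := fun i => hx _ _ rfl
    simp only [h3, ← sub_mul]
    rw [← Finset.sum_mul, Finset.sum_sub_distrib, Finset.sum_const, Finset.card_univ,
      Fintype.card_fin, nsmul_eq_mul, mul_div_cancel₀ _ m.I_pos'.ne']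
    simp [pathSum]
  simp only [h1]
  rw [Finset.sum_add_distrib, ← Finset.mul_sum, h2, mul_zero, add_zero]

/-- In the degenerate interior case, there is a weak Lyapunov function that controls the path sums,
and the vector field is the drift. -/
lemma exists_degenerate_lyapunov (h : m.T₃ ≤ 0) (hφ : m.φ₁ = 0) (hA : 0 < m.equilibriumSum) :
    ∃ V V', ∃ η q β s l ε : ℝ, 0 < β ∧ 0 < s ∧
      (∀ w, β * ∑ r, m.pathSum w r ^ 2 ≤ 2 * m.quadForm 0 η q w) ∧
      m.IsLyapunovFunction m.equilibriumProfile V V'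
        (fun a => -(s * m.quadForm 0 η q (a - m.equilibriumProfile))) l ε ∧
      (∀ a : m.ISP → ℝ, (∀ n, 0 ≤ a n) → ‖a - m.equilibriumProfile‖ < ε →
        m.field a = m.drift a ∧ ∑ n, m.linForm 0 η q (a - m.equilibriumProfile) n * m.field a n ≤
          -(s * m.quadForm 0 η q (a - m.equilibriumProfile))) := by
  obtain ⟨θ, η, q, β, hβ, h1, h2, -, -, hθ, hlin⟩ := m.exists_linearization h
  obtain rfl := hθ hφ
  set e := m.equilibriumProfile with he
  have hge : ∀ w, β * ∑ r, m.pathSum w r ^ 2 ≤ 2 * m.quadForm 0 η q w := fun w => by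
    simpa using m.quadForm_ge (θ := 0) h1 h2 w
  have hV0 : ∀ w, 0 ≤ m.quadForm 0 η q w := fun w => by
    have := hge w
    have : 0 ≤ β * ∑ r, m.pathSum w r ^ 2 :=
      mul_nonneg hβ.le (Finset.sum_nonneg fun r _ => sq_nonneg _)
    linarith
  obtain ⟨s, hs, ε₁, hε₁, hdec⟩ := m.quadForm_decay (half_pos hβ) m.equilibriumProfile_nonneg hlin
  have hint : ∀ᶠ a in 𝓝 e, ∀ n, 0 < a n ∧ 0 < a n + m.drift a n := by
    refine eventually_all.2 fun n => ?_
    have hd := m.drift_equilibriumProfile h n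
    have hen : 0 < e n := hA
    refine (continuousAt_const.eventually_lt (continuous_apply n).continuousAt hen).and
      (continuousAt_const.eventually_lt
        ((continuous_apply n).add (m.continuous_drift n)).continuousAt ?_)
    change 0 < e n + m.drift m.equilibriumProfile n
    rwa [hd, add_zero]
  obtain ⟨ε₂, hε₂, hball⟩ := Metric.eventually_nhds_iff.1 hint
  have hfield : ∀ a, ‖a - e‖ < ε₂ → m.field a = m.drift a := fun a ha => by
    ext n
    rw [← dist_eq_norm] at ha
    rw [field, bestResponse, max_eq_right (hball ha n).2.le, add_sub_cancel_left]
  have hdecay : ∀ a : m.ISP → ℝ, ‖a - e‖ < min ε₁ ε₂ →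
      ∑ n, m.linForm 0 η q (a - e) n * m.field a n ≤ -(s * m.quadForm 0 η q (a - e)) := by
    intro a ha
    -- `quadForm_decay` needs the form to control the norm, which fails at `a` but holds for path
    -- averages. All quantities involved depend on path sums only, so the estimate at `b` transfers
    -- to `a`.
    set b := m.pathAverage (a - e) + e with hb
    have hbe : b - e = m.pathAverage (a - e) := add_sub_cancel_right _ _
    have hbn : ‖b - e‖ < min ε₁ ε₂ := hbe ▸ (m.norm_pathAverage_le _).trans_lt ha
    have hps : ∀ r, m.pathSum (a - e) r = m.pathSum (b - e) r := fun r => by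
      rw [hbe, pathSum_pathAverage]
    have hps' : ∀ r, m.pathSum a r = m.pathSum b r := fun r => by
      have := hps r
      rw [pathSum_sub, pathSum_sub] at this
      linarith
    rw [m.quadForm_eq_of_pathSum_eq η q hps, hfield a (ha.trans_le (min_le_right _ _))]
    have h3 := hdec b
      (fun n => (hball (by rw [dist_eq_norm]; exact hbn.trans_le (min_le_right _ _)) n).1.le)
      (hbn.trans_le (min_le_left _ _)) (by
        have h4 := mul_le_mul_of_nonneg_left (m.sq_norm_pathAverage_le (a - e)) hβ.le
        have h5 := hge (a - e)
        rw [← m.quadForm_eq_of_pathSum_eq η q hps, hbe]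
        linarith)
    rw [hfield b (hbn.trans_le (min_le_right _ _))] at h3
    refine le_trans (le_of_eq (Finset.sum_congr rfl fun n _ => ?_)) h3
    rw [m.linForm_eq_of_pathSum_eq η q hps n, m.drift_eq_of_pathSum_eq hφ hps' rfl]
  refine ⟨fun a => m.quadForm 2 (η - 2 / m.I) q (a - e),
    fun a x => ∑ n, m.linForm 2 (η - 2 / m.I) q (a - e) n * x n, η, q, β, s, min β 2 / 2,
    min ε₁ ε₂, hβ, hs, hge, ⟨by positivity, lt_min hε₁ hε₂, ?_, ?_,
    m.hasDerivWithinAt_quadForm _ _ _ e, ?_, ?_, ?_⟩, ?_⟩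
  · exact (m.continuous_quadForm _ _ _).comp (continuous_id.sub continuous_const)
  · simp [quadForm]
  · intro a _ _
    have h3 := m.quadForm_add_spread η q (a - e)
    have h4 := hge (a - e)
    have h5 := sq_norm_le_sum_sq (a - e)
    have h6 := m.sum_sq_pathSum_le (a - e)
    have h0 : 0 ≤ ∑ r, m.pathSum (a - e) r ^ 2 := Finset.sum_nonneg fun r _ => sq_nonneg _
    set X := ∑ n, (a - e) n ^ 2
    set Y := ∑ r, m.pathSum (a - e) r ^ 2
    have h7 : Y / m.I ≤ X := by rw [div_le_iff₀ m.I_pos']; linarith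
    have h8 : Y / m.I ≤ Y := div_le_self h0 m.one_le_I
    have h9 : 0 ≤ Y / m.I := div_nonneg h0 m.I_pos'.le
    have ha : min β 2 ≤ β := min_le_left _ _
    have hb : min β 2 ≤ 2 := min_le_right _ _
    have hc : 0 < min β 2 := by positivity
    have hd := mul_le_mul_of_nonneg_left h5 hc.le
    -- Split `X = Y / I + (X - Y / I)`: the first part is controlled by `β Y`, the second by the
    -- spread term with factor `2`.
    have he1 : min β 2 * (Y / m.I) ≤ β * Y := mul_le_mul ha h8 h9 hβ.le
    have he2 := mul_le_mul_of_nonneg_right hb (sub_nonneg.2 h7)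
    linarith
  · intro a _ ha
    refine le_trans (le_of_eq (m.sum_linForm_add_spread η q _ _ fun n n' hn => ?_)) (hdecay a ha)
    rw [hfield a (ha.trans_le (min_le_right _ _)), m.drift_eq_of_pathSum_eq hφ (fun _ => rfl) hn]
  · exact fun a _ _ => neg_nonpos.2 (mul_nonneg hs.le (hV0 _))
  · exact fun a _ ha => ⟨hfield a (ha.trans_le (min_le_right _ _)), hdecay a ha⟩

lemma eq_of_hasDerivWithinAt_zero {f : ℝ → ℝ}
    (h : ∀ t, 0 ≤ t → HasDerivWithinAt f 0 (Set.Ici 0) t) {t : ℝ} (ht : 0 ≤ t) : f t = f 0 := by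
  have key : ∀ g : ℝ → ℝ, (∀ t, 0 ≤ t → HasDerivWithinAt g 0 (Set.Ici 0) t) → g t ≤ g 0 :=
    fun g hg => by
      have := le_mul_exp_of_hasDerivWithinAt (v' := fun _ => 0) (s := 0) hg (by simp) ht
      simpa using this
  have h1 := key f h
  have h2 := key (fun t => -f t) (fun t ht => (h t ht).fun_neg.congr_deriv neg_zero)
  linarith

lemma degenerate_stability (h : m.T₃ ≤ 0) (hφ : m.φ₁ = 0) (hA : 0 < m.equilibriumSum) :
    m.IsLyapunovStable m.equilibriumProfile ∧
    ∃ δ > 0, ∀ a, m.IsSolution a → dist (a 0) m.equilibriumProfile < δ →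
      ∃ e, m.IsEquilibrium e ∧ Tendsto a atTop (𝓝 e) := by
  obtain ⟨V, V', η, q, β, s, l, ε, hβ, hs, hge, hV, hf⟩ := m.exists_degenerate_lyapunov h hφ hA
  refine ⟨hV.isLyapunovStable
    (m.exists_lipschitzOnWith_bestResponse (m.radicand_equilibriumProfile_ne_zero h)), ?_⟩
  obtain ⟨δ, hδ, hmem⟩ := hV.exists_mem_ball (half_pos hV.ε_pos) (half_lt_self hV.ε_pos)
  refine ⟨δ, hδ, fun a ha h0 => ?_⟩
  set e := m.equilibriumProfile with he
  have hlt : ∀ t, 0 ≤ t → ‖a t - e‖ < ε := fun t ht =>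
    (hmem a ha h0 t ht).trans (half_lt_self hV.ε_pos)
  rw [isSolution_iff] at ha
  have hdecay : ∀ t, 0 ≤ t → m.quadForm 0 η q (a t - e) ≤
      m.quadForm 0 η q (a 0 - e) * Real.exp (-(s * t)) := fun t ht =>
    le_mul_exp_of_hasDerivWithinAt (v := fun t => m.quadForm 0 η q (a t - e))
      (fun t ht => m.hasDerivWithinAt_quadForm 0 η q e a _ _ t (ha t ht).2)
      (fun t ht => (hf _ (ha t ht).1 (hlt t ht)).2) ht
  have hpath : ∀ r, Tendsto (fun t => m.pathSum (a t - e) r) atTop (𝓝 0) := fun r => by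
    have hsq : Tendsto (fun t => m.pathSum (a t - e) r ^ 2) atTop (𝓝 0) := by
      refine squeeze_zero' (Eventually.of_forall fun t => sq_nonneg _) ?_
        (tendsto_mul_exp_neg_atTop (2 * m.quadForm 0 η q (a 0 - e) / β) hs)
      filter_upwards [eventually_ge_atTop 0] with t ht
      have h1 := hdecay t ht
      have h2 := hge (a t - e)
      have h3 : m.pathSum (a t - e) r ^ 2 ≤ ∑ r, m.pathSum (a t - e) r ^ 2 :=
        Finset.single_le_sum (f := fun r => m.pathSum (a t - e) r ^ 2) (fun r _ => sq_nonneg _)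
          (Finset.mem_univ r)
      have h4 := mul_le_mul_of_nonneg_left h3 hβ.le
      rw [div_mul_eq_mul_div, le_div_iff₀ hβ]
      linarith
    rw [tendsto_zero_iff_abs_tendsto_zero]
    simpa [Function.comp_def, Real.sqrt_sq_eq_abs] using hsq.sqrt
  -- Conserved quantity: all ISPs on a path have the same drift, which equals its own path average.
  -- With vanishing path deviations this identifies the limit `k`.
  have hconst : ∀ n t, 0 ≤ t → a t n - m.pathSum (a t - e) n.1 / m.I =
      a 0 n - m.pathSum (a 0 - e) n.1 / m.I := fun n t ht => by
    refine eq_of_hasDerivWithinAt_zero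
      (f := fun t => a t n - m.pathSum (a t - e) n.1 / m.I) (fun t ht => ?_) ht
    have hd := hasDerivWithinAt_pi.1 (ha t ht).2
    have hp : HasDerivWithinAt (fun t => m.pathSum (a t - e) n.1)
        (m.pathSum (m.field (a t)) n.1) (Set.Ici 0) t :=
      HasDerivWithinAt.fun_sum fun i _ => (hd (n.1, i)).sub_const _
    refine ((hd n).sub (hp.div_const m.I)).congr_deriv ?_
    rw [(hf _ (ha t ht).1 (hlt t ht)).1]
    have h1 : m.pathSum (m.drift (a t)) n.1 = m.I * m.drift (a t) n := by
      rw [pathSum, Finset.sum_congr rfl fun i _ =>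
        m.drift_eq_of_pathSum_eq hφ (fun _ => rfl) (show (n.1, i).1 = n.1 from rfl)]
      simp
    rw [h1, mul_div_cancel_left₀ _ m.I_pos'.ne', sub_self]
  set k : m.ISP → ℝ := fun n => a 0 n - m.pathSum (a 0 - e) n.1 / m.I with hk
  have hlim : Tendsto a atTop (𝓝 k) := by
    refine tendsto_pi_nhds.2 fun n => ?_
    have h1 : Tendsto (fun t => k n + m.pathSum (a t - e) n.1 / m.I) atTop (𝓝 (k n)) := by
      simpa using ((hpath n.1).div_const (m.I : ℝ)).const_add (k n)
    refine h1.congr' ?_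
    filter_upwards [eventually_ge_atTop 0] with t ht
    have := hconst n t ht
    simp only [hk]
    linarith
  refine ⟨k, (m.isEquilibrium_iff k).2 ?_, hlim⟩
  have hk0 : ∀ n, 0 ≤ k n := fun n =>
    ge_of_tendsto (tendsto_pi_nhds.1 hlim n)
      ((eventually_ge_atTop 0).mono fun t ht => (ha t ht).1 n)
  have hpk : ∀ r, m.pathSum k r = m.pathSum e r := fun r => by
    have hc : Continuous fun a : m.ISP → ℝ => m.pathSum (a - e) r := by
      unfold pathSum; fun_prop
    have h1 := tendsto_nhds_unique ((hc.tendsto k).comp hlim) (hpath r)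
    rw [pathSum_sub] at h1
    linarith
  refine ⟨hk0, fun n => ?_⟩
  rw [bestResponse, m.drift_eq_of_pathSum_eq hφ hpk (rfl : n.1 = n.1),
    m.drift_equilibriumProfile h, add_zero, max_eq_right (hk0 n)]

end HomogeneousMarket

end

theorem mainTheorem3 (m : HomogeneousMarket) :
    -- the attribute matrices with attribute sums `a⁺` are Nash equilibria
    (∀ A : m.ISP → Fin m.K → ℝ, (∀ n k, 0 ≤ A n k) →
      m.attributeSum A = m.equilibriumProfile → m.IsNash A) ∧
    m.IsEquilibrium m.equilibriumProfile ∧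
    -- asymptotic stability, unless `φ₁ = 0`, `I ≥ 2` and `â⁺ > 0`
    ((0 < m.φ₁ ∨ m.I = 1 ∨ m.unrestrictedSum ≤ 0) →
      m.IsAsymptoticallyStable m.equilibriumProfile) ∧
    -- in every case: stability, and convergence of nearby solutions to an equilibrium
    m.IsLyapunovStable m.equilibriumProfile ∧
    (∃ δ > 0, ∀ a, m.IsSolution a → dist (a 0) m.equilibriumProfile < δ →
      ∃ e, m.IsEquilibrium e ∧ Tendsto a atTop (𝓝 e)) := by
  have heq : m.IsEquilibrium m.equilibriumProfile :=
    (m.isEquilibrium_iff _).2 ⟨m.equilibriumProfile_nonneg, m.bestResponse_equilibriumProfile⟩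
  have hasymp : (0 < m.φ₁ ∨ m.I = 1 ∨ m.unrestrictedSum ≤ 0) →
      m.IsAsymptoticallyStable m.equilibriumProfile := fun hcase => by
    rcases le_or_gt m.T₃ 0 with h | h
    · exact m.isAsymptoticallyStable_of_T₃_nonpos h
        (hcase.imp_right (Or.imp_right max_eq_left))
    · exact m.isAsymptoticallyStable_of_T₃_pos h
  refine ⟨fun A hA hsum => (m.isNash_iff A hA).2 fun n => ?_, heq, hasymp, ?_⟩
  · rw [hsum, m.bestResponse_equilibriumProfile n]
  · by_cases hcase : 0 < m.φ₁ ∨ m.I = 1 ∨ m.unrestrictedSum ≤ 0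
    · obtain ⟨h1, δ, hδ, h2⟩ := hasymp hcase
      exact ⟨h1, δ, hδ, fun a ha h0 => ⟨_, heq, h2 a ha h0⟩⟩
    · push Not at hcase
      obtain ⟨h1, -, h3⟩ := hcase
      have hA : 0 < m.equilibriumSum := h3.trans_le (le_max_right _ _)
      refine m.degenerate_stability ?_ (le_antisymm h1 m.φ₁_nonneg) hA
      by_contra h
      exact hA.ne' (m.equilibriumSum_of_nonneg (not_le.1 h).le)
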